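/- **Theorem 1.** Let $n\ge 0$ and let $\mathbf E$ be the set of all linear subspaces of $\mathbb R^n$. For $E\in\mathbf E$ let $P_E$ be the orthogonal projection of $\mathbb R^n$ onto $E$, and equip $\mathbf E$ with the coarsest topology making $E\mapsto P_E\in M_{n\times n}(\mathbb R)$ continuous and with the corresponding Borel $\sigma$-algebra. For a topological space $\mathsf X$, $P(\mathsf X)$ denotes the set of Borel probability measures on $\mathsf X$. For $\mu\in P(\mathbb R^n)$ and $E\in\mathbf E$, let $\mu_E\in P(E)$ be the marginal of $\mu$ on $E$, i.e. its pushforward under the orthogonal projection $\mathbb R^n\to E$. For mutually orthogonal subspaces with sum $\mathbb R^n$, a product of measures on these subspaces is regarded as a measure on $\mathbb R^n$. Fix $\xi\in P(\mathbf E)$ and put $$\chi_\xi(x)=\int_{\mathbf E}\min\{\|P_Ex\|,\|P_{E^\perp}x\|\}\,d\xi(E),\qquad x\in\mathbb R^n .$$ There is a unique (finite, possibly empty) family $(E_\alpha)_\alpha$ of distinct, nonzero, mutually orthogonal subspaces such that $\chi_\xi^{-1}(0)=\{0\}\cup\bigcup_\alpha E_\alpha$. These $E_\alpha$ are called the independent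 subspaces with respect to $\xi$, and $E_{dep}:=\left(\bigoplus_\alpha E_\alpha\right)^\perp$ is called the dependent subspace. For every $\mu\in P(\mathbb R^n)$ the following are equivalent: 1. $\mu$ splits with respect to $\xi$, that is, $\mu=\mu_E\otimes\mu_{E^\perp}$ for $\xi$-a.e. $E\in\mathbf E$. 2. $\mu=\left(\bigotimes_\alpha\mu_{E_\alpha}\right)\otimes\mu_{E_{dep}}$, where $\mu_{E_{dep}}$ is a (possibly degenerate, not necessarily centered) Gaussian measure whose covariance splits with respect to $\xi$, that is, $$\int_{\mathbf E}\left\|P_E\,\operatorname{Cov}(P_{E_{dep}}\#\mu)\,P_{E^\perp}\right\|\,d\xi(E)=0,$$ where $P_{E_{dep}}\#\mu$ is the pushforward of $\mu$ under $P_{E_{dep}}$ (the choice of matrix norm is immaterial). 3. $\int_{E_{dep}}\log(1+\|x\|)\,d\mu_{E_{dep}}(x)<\infty$, and $\mu$ is the mixture $$\mu=\int_{\mathbf E}(\mu_E\otimes\mu_{E^\perp})\,d\xi(E).$$ -/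

import Mathlib

open MeasureTheory ProbabilityTheory

namespace SplittingMeasures

/-- `ℝⁿ` with its Euclidean structure. -/
abbrev Euc (n : ℕ) : Type := EuclideanSpace ℝ (Fin n)

/-- The set of all linear subspaces of `ℝⁿ`. -/
abbrev Subsp (n : ℕ) : Type := Submodule ℝ (Euc n)

/-- The coarsest topology on the set of subspaces that makes `E ↦ P_E` continuous. The projections
are taken as continuous endomorphisms of `ℝⁿ`; this finite-dimensional space has the same topology
as the space of matrices. -/
noncomputable instance instTopologicalSpaceSubsp (n : ℕ) : TopologicalSpace (Subsp n) :=
  TopologicalSpace.induced (fun E : Subsp n => E.starProjection) inferInstance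

/-- The Borel σ-algebra on the set of subspaces. -/
noncomputable instance instMeasurableSpaceSubsp (n : ℕ) : MeasurableSpace (Subsp n) := borel (Subsp n)

instance instBorelSpaceSubsp (n : ℕ) : BorelSpace (Subsp n) := ⟨rfl⟩

variable {n : ℕ}

/-- The marginal `μ_E`, a measure on `E`: the pushforward of `μ` by the orthogonal projection
`ℝⁿ → E`. -/
noncomputable def marginal (μ : Measure (Euc n)) (E : Subsp n) : Measure E :=
  μ.map E.orthogonalProjectionOnto

/-- The product `μ_E ⊗ μ_{E^⊥}`, a measure on `ℝⁿ = E ⊕ E^⊥`. -/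
noncomputable def marginalProd (μ : Measure (Euc n)) (E : Subsp n) : Measure (Euc n) :=
  ((marginal μ E).prod (marginal μ Eᗮ)).map fun p : E × (Eᗮ : Subsp n) => (p.1 : Euc n) + p.2

/-- `μ` splits along `(E, E^⊥)`. -/
def SplitsAlong (μ : Measure (Euc n)) (E : Subsp n) : Prop :=
  μ = marginalProd μ E

/-- `μ` splits with respect to `ξ`. -/
def SplitsWrt (μ : Measure (Euc n)) (ξ : Measure (Subsp n)) : Prop :=
  ∀ᵐ E ∂ξ, SplitsAlong μ E

/-- The function `χ_ξ(x) = ∫ min(‖P_E x‖, ‖P_{E^⊥} x‖) dξ(E)`. -/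
noncomputable def chi (ξ : Measure (Subsp n)) (x : Euc n) : ℝ :=
  ∫ E, min ‖E.starProjection x‖ ‖(Eᗮ : Subsp n).starProjection x‖ ∂ξ

/-- The independent subspaces with respect to `ξ`: the nonzero subspaces that are maximal among
the subspaces contained in the zero set of `χ_ξ`. By `isIndependentFamily_iff` below this is the
unique family of nonzero, mutually orthogonal subspaces whose union (with `0`) is the zero set. -/
def independentSubspaces (ξ : Measure (Subsp n)) : Set (Subsp n) :=
  {E | E ≠ ⊥ ∧ Maximal (fun F : Subsp n => ∀ x ∈ F, chi ξ x = 0) E}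

/-- `S` is a family of distinct, nonzero, mutually orthogonal subspaces whose union, together with
`0`, is the zero set of `χ_ξ`. -/
def IsIndependentFamily (ξ : Measure (Subsp n)) (S : Set (Subsp n)) : Prop :=
  (∀ E ∈ S, E ≠ ⊥) ∧ (S.Pairwise fun E F => E ⟂ F) ∧
    {x | chi ξ x = 0} = {0} ∪ ⋃ E ∈ S, (E : Set (Euc n))

/-- The dependent subspace with respect to `ξ`: the orthogonal complement of the sum of the
independent subspaces. -/
noncomputable def depSubspace (ξ : Measure (Subsp n)) : Subsp n :=
  (sSup (independentSubspaces ξ))ᗮ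

/-! The independent decomposition is well defined. -/

theorem continuous_starProjection_subsp :
    Continuous fun E : Subsp n => E.starProjection :=
  continuous_induced_dom

theorem continuous_starProjection_orthogonal_subsp :
    Continuous fun E : Subsp n => (Eᗮ : Subsp n).starProjection := by
  simp_rw [Submodule.starProjection_orthogonal]
  exact continuous_const.sub continuous_starProjection_subsp

theorem min_norm_eq_zero_iff (E : Subsp n) (x : Euc n) :
    min ‖E.starProjection x‖ ‖(Eᗮ : Subsp n).starProjection x‖ = 0 ↔ x ∈ E ∨ x ∈ Eᗮ := by
  have h1 : ‖E.starProjection x‖ = 0 ↔ x ∈ Eᗮ := by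
    rw [norm_eq_zero, Submodule.starProjection_apply_eq_zero_iff]
  have h2 : ‖(Eᗮ : Subsp n).starProjection x‖ = 0 ↔ x ∈ E := by
    rw [norm_eq_zero, Submodule.starProjection_apply_eq_zero_iff, Submodule.orthogonal_orthogonal]
  rw [← h1, ← h2]
  have a := norm_nonneg (E.starProjection x)
  have b := norm_nonneg ((Eᗮ : Subsp n).starProjection x)
  constructor
  · intro h
    rcases min_choice ‖E.starProjection x‖ ‖(Eᗮ : Subsp n).starProjection x‖ with h' | h'
    · right; rw [← h', h]
    · left; rw [← h', h]
  · rintro (h | h)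
    · rw [h]; exact min_eq_right a
    · rw [h]; exact min_eq_left b

theorem integrable_min_norm (ξ : Measure (Subsp n)) [IsProbabilityMeasure ξ] (x : Euc n) :
    Integrable (fun E : Subsp n =>
      min ‖E.starProjection x‖ ‖(Eᗮ : Subsp n).starProjection x‖) ξ := by
  have hc : Continuous (fun E : Subsp n =>
      min ‖E.starProjection x‖ ‖(Eᗮ : Subsp n).starProjection x‖) :=
    (continuous_starProjection_subsp.clm_apply continuous_const).norm.min
      (continuous_starProjection_orthogonal_subsp.clm_apply continuous_const).norm
  refine Integrable.of_bound hc.measurable.aestronglyMeasurable ‖x‖ (Filter.Eventually.of_forall ?_)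
  intro E
  rw [Real.norm_of_nonneg (le_min (norm_nonneg _) (norm_nonneg _))]
  exact (min_le_left _ _).trans (E.norm_starProjection_apply_le x)

theorem chi_eq_zero_iff (ξ : Measure (Subsp n)) [IsProbabilityMeasure ξ] (x : Euc n) :
    chi ξ x = 0 ↔ ∀ᵐ E : Subsp n ∂ξ, x ∈ E ∨ x ∈ (Eᗮ : Subsp n) := by
  unfold chi
  rw [integral_eq_zero_iff_of_nonneg (fun E => le_min (norm_nonneg _) (norm_nonneg _))
    (integrable_min_norm ξ x)]
  simp only [Filter.EventuallyEq, Pi.zero_apply, min_norm_eq_zero_iff]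

/-- If `u ≠ 0` and `u`, `v`, `u + v` all lie in `E ∪ E^⊥`, then `v` lies on the same side as `u`. -/
theorem same_side {E : Subsp n} {u v : Euc n} (hu0 : u ≠ 0) (hv : v ∈ E ∨ v ∈ Eᗮ)
    (huv : u + v ∈ E ∨ u + v ∈ Eᗮ) (hu : u ∈ E) : v ∈ E := by
  rcases huv with h | h
  · simpa using E.sub_mem h hu
  · rcases hv with hv | hv
    · exact hv
    · have hu' : u ∈ Eᗮ := by simpa using Eᗮ.sub_mem h hv
      exact absurd (inner_self_eq_zero.1 ((Submodule.mem_orthogonal E u).1 hu' u hu)) hu0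

theorem same_side_orthogonal {E : Subsp n} {u v : Euc n} (hu0 : u ≠ 0) (hv : v ∈ E ∨ v ∈ Eᗮ)
    (huv : u + v ∈ E ∨ u + v ∈ Eᗮ) (hu : u ∈ Eᗮ) : v ∈ Eᗮ := by
  refine same_side hu0 ?_ ?_ hu
  · rw [Submodule.orthogonal_orthogonal]; exact hv.symm
  · rw [Submodule.orthogonal_orthogonal]; exact huv.symm

theorem independentSubspaces_pairwise (ξ : Measure (Subsp n)) [IsProbabilityMeasure ξ] :
    (independentSubspaces ξ).Pairwise fun E F => E ⟂ F := by
  rintro U ⟨-, hU⟩ V ⟨-, hV⟩ hne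
  by_contra hnot
  rw [Submodule.isOrtho_iff_inner_eq] at hnot
  push Not at hnot
  obtain ⟨u, hu, v, hv, huv⟩ := hnot
  have hu0 : u ≠ 0 := by rintro rfl; simp at huv
  have hv0 : v ≠ 0 := by rintro rfl; simp at huv
  have hsup : ∀ x ∈ U ⊔ V, chi ξ x = 0 := by
    intro x hx
    obtain ⟨u', hu', v', hv', rfl⟩ := Submodule.mem_sup.1 hx
    rw [chi_eq_zero_iff]
    filter_upwards [(chi_eq_zero_iff ξ _).1 (hU.prop u hu), (chi_eq_zero_iff ξ _).1 (hV.prop v hv),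
      (chi_eq_zero_iff ξ _).1 (hU.prop u' hu'), (chi_eq_zero_iff ξ _).1 (hV.prop v' hv'),
      (chi_eq_zero_iff ξ _).1 (hU.prop _ (U.add_mem hu hu')),
      (chi_eq_zero_iff ξ _).1 (hV.prop _ (V.add_mem hv hv'))] with E h1 h2 h3 h4 h5 h6
    rcases h1 with h1 | h1 <;> rcases h2 with h2 | h2
    · exact Or.inl (E.add_mem (same_side hu0 h3 h5 h1) (same_side hv0 h4 h6 h2))
    · exact absurd ((Submodule.mem_orthogonal E v).1 h2 u h1) huv
    · exact absurd ((Submodule.mem_orthogonal' E u).1 h1 v h2) huv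
    · exact Or.inr (Eᗮ.add_mem (same_side_orthogonal hu0 h3 h5 h1)
        (same_side_orthogonal hv0 h4 h6 h2))
  exact hne ((hU.eq_of_le hsup le_sup_left).trans (hV.eq_of_le hsup le_sup_right).symm)

theorem chi_zero (ξ : Measure (Subsp n)) : chi ξ 0 = 0 := by
  simp [chi]

theorem chi_smul_eq_zero (ξ : Measure (Subsp n)) [IsProbabilityMeasure ξ] {x : Euc n}
    (hx : chi ξ x = 0) (c : ℝ) : chi ξ (c • x) = 0 := by
  rw [chi_eq_zero_iff] at hx ⊢
  filter_upwards [hx] with E hE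
  exact hE.imp (E.smul_mem c) (Eᗮ.smul_mem c)

theorem isIndependentFamily_independentSubspaces (ξ : Measure (Subsp n)) [IsProbabilityMeasure ξ] :
    IsIndependentFamily ξ (independentSubspaces ξ) := by
  refine ⟨fun E hE => hE.1, independentSubspaces_pairwise ξ, ?_⟩
  ext x
  simp only [Set.mem_ofPred_eq, Set.mem_union, Set.mem_singleton_iff, Set.mem_iUnion,
    SetLike.mem_coe, exists_prop]
  constructor
  · intro hx
    by_cases hx0 : x = 0
    · exact Or.inl hx0
    · right
      obtain ⟨E, hle, hE⟩ := exists_maximal_ge_of_wellFoundedGT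
        (fun F : Subsp n => ∀ x ∈ F, chi ξ x = 0) (Submodule.span ℝ {x}) (by
          intro y hy
          obtain ⟨c, rfl⟩ := Submodule.mem_span_singleton.1 hy
          exact chi_smul_eq_zero ξ hx c)
      have hxE : x ∈ E := hle (Submodule.mem_span_singleton_self x)
      refine ⟨E, ⟨?_, hE⟩, hxE⟩
      rintro rfl
      exact hx0 ((Submodule.mem_bot ℝ).1 hxE)
  · rintro (rfl | ⟨E, hE, hx⟩)
    · exact chi_zero ξ
    · exact hE.2.prop x hx

/-- Existence and uniqueness of the decomposition of the zero set of `χ_ξ`. -/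
theorem isIndependentFamily_iff (ξ : Measure (Subsp n)) [IsProbabilityMeasure ξ]
    (S : Set (Subsp n)) : IsIndependentFamily ξ S ↔ S = independentSubspaces ξ := by
  refine ⟨?_, fun h => h ▸ isIndependentFamily_independentSubspaces ξ⟩
  rintro ⟨hne, hpw, hZ⟩
  have hmem : ∀ x : Euc n, chi ξ x = 0 → x ≠ 0 → ∃ E ∈ S, x ∈ E := by
    intro x hx hx0
    have h : x ∈ {x | chi ξ x = 0} := hx
    rw [hZ] at h
    simpa [hx0] using h
  have hsub : ∀ E ∈ S, ∀ x ∈ E, chi ξ x = 0 := by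
    intro E hE x hx
    have h : x ∈ {x | chi ξ x = 0} := by
      rw [hZ]
      exact Or.inr (Set.mem_biUnion hE hx)
    exact h
  have key : ∀ E ∈ S, ∀ F : Subsp n, (∀ x ∈ F, chi ξ x = 0) → ∀ e ∈ E, e ≠ 0 → e ∈ F → F ≤ E := by
    intro E hE F hF e heE he0 heF f hf
    by_cases hf0 : f = 0
    · rw [hf0]; exact E.zero_mem
    by_cases hs : e + f = 0
    · rw [← neg_eq_of_add_eq_zero_right hs]; exact E.neg_mem heE
    obtain ⟨E1, hE1, hf1⟩ := hmem f (hF f hf) hf0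
    obtain ⟨E2, hE2, hs2⟩ := hmem (e + f) (hF _ (F.add_mem heF hf)) hs
    by_cases h1 : E1 = E
    · rwa [h1] at hf1
    by_cases h2 : E2 = E
    · rw [h2] at hs2
      simpa using E.sub_mem hs2 heE
    have i1 : inner ℝ f e = 0 := Submodule.isOrtho_iff_inner_eq.1 (hpw hE1 hE h1) f hf1 e heE
    have i2 : inner ℝ (e + f) e = 0 :=
      Submodule.isOrtho_iff_inner_eq.1 (hpw hE2 hE h2) _ hs2 e heE
    rw [inner_add_left, i1, add_zero] at i2
    exact absurd (inner_self_eq_zero.1 i2) he0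
  ext E
  constructor
  · intro hE
    obtain ⟨e, he, he0⟩ := Submodule.exists_mem_ne_zero_of_ne_bot (hne E hE)
    exact ⟨hne E hE, hsub E hE, fun F hF hle => key E hE F hF e he he0 (hle he)⟩
  · rintro ⟨hb, hmax⟩
    obtain ⟨e, he, he0⟩ := Submodule.exists_mem_ne_zero_of_ne_bot hb
    obtain ⟨E', hE', heE'⟩ := hmem e (hmax.prop e he) he0
    have := hmax.eq_of_le (hsub E' hE') (key E' hE' E hmax.prop e heE' he0 he)
    rwa [this]

theorem finite_independentSubspaces (ξ : Measure (Subsp n)) [IsProbabilityMeasure ξ] :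
    Finite (independentSubspaces ξ) := by
  have hort : OrthogonalFamily ℝ (fun E : independentSubspaces ξ => (E : Subsp n))
      fun E => (E : Subsp n).subtypeₗᵢ := by
    intro E F hEF v w
    exact Submodule.isOrtho_iff_inner_eq.1
      (independentSubspaces_pairwise ξ E.2 F.2 (fun h => hEF (Subtype.ext h))) v v.2 w w.2
  exact WellFoundedGT.finite_of_iSupIndep hort.independent fun E => E.2.1

noncomputable instance instFintypeIndependentSubspaces (ξ : Measure (Subsp n))
    [IsProbabilityMeasure ξ] : Fintype (independentSubspaces ξ) :=
  haveI := finite_independentSubspaces ξ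
  Fintype.ofFinite _

/-- The product `(⊗_α μ_{E_α}) ⊗ μ_{E_dep}`, a measure on `ℝⁿ = (⊕_α E_α) ⊕ E_dep`. -/
noncomputable def independentProd (ξ : Measure (Subsp n)) [IsProbabilityMeasure ξ]
    (μ : Measure (Euc n)) : Measure (Euc n) :=
  ((Measure.pi fun α : independentSubspaces ξ => marginal μ α.1).prod
      (marginal μ (depSubspace ξ))).map
    fun p : ((α : independentSubspaces ξ) → α.1) × depSubspace ξ =>
      (∑ α, (p.1 α : Euc n)) + p.2

/-- The (centered) covariance of a measure on `ℝⁿ`, as an operator `C` on `ℝⁿ` with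
`⟪C x, y⟫ = Cov(⟪x, ·⟫, ⟪y, ·⟫)`. -/
noncomputable def covOp (ν : Measure (Euc n)) : Euc n →L[ℝ] Euc n :=
  InnerProductSpace.continuousLinearMapOfBilin (𝕜 := ℝ) (covarianceBilin ν)

/-- The covariance of `μ_V` splits with respect to `ξ`:
`∫ ‖P_E Cov(P_V # μ) P_{E^⊥}‖ dξ(E) = 0`. -/
def CovSplits (μ : Measure (Euc n)) (V : Subsp n) (ξ : Measure (Subsp n)) : Prop :=
  ∫ E, ‖E.starProjection ∘L covOp (μ.map V.starProjection) ∘L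
    (Eᗮ : Subsp n).starProjection‖ ∂ξ = 0

/-- `E ↦ μ_E ⊗ μ_{E^⊥}` is measurable, so that the mixture `∫ (μ_E ⊗ μ_{E^⊥}) dξ(E)` is the
measure `ξ.bind (marginalProd μ)`. -/
theorem measurable_marginalProd (μ : Measure (Euc n)) [IsProbabilityMeasure μ] :
    Measurable (marginalProd μ) := by
  have h : Measurable fun q : Subsp n × (Euc n × Euc n) =>
      q.1.starProjection q.2.1 + (q.1ᗮ : Subsp n).starProjection q.2.2 := by
    have a : Measurable fun p : (Euc n →L[ℝ] Euc n) × Euc n => p.1 p.2 :=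
      ContinuousLinearMap.measurable_apply₂
    exact (a.comp ((continuous_starProjection_subsp.measurable.comp measurable_fst).prodMk
      (measurable_fst.comp measurable_snd))).add
      (a.comp ((continuous_starProjection_orthogonal_subsp.measurable.comp measurable_fst).prodMk
      (measurable_snd.comp measurable_snd)))
  have heq : ∀ E : Subsp n, marginalProd μ E = (μ.prod μ).map fun q : Euc n × Euc n =>
      E.starProjection q.1 + (Eᗮ : Subsp n).starProjection q.2 := by
    intro E
    unfold marginalProd marginal
    rw [Measure.map_prod_map _ _ (by fun_prop) (by fun_prop), Measure.map_map (by fun_prop)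
      (by fun_prop)]
    rfl
  refine Measure.measurable_of_measurable_coe _ fun s hs => ?_
  have : (fun E => marginalProd μ E s) = fun E : Subsp n => (μ.prod μ) (Prod.mk E ⁻¹'
      ((fun q : Subsp n × (Euc n × Euc n) =>
      q.1.starProjection q.2.1 + (q.1ᗮ : Subsp n).starProjection q.2.2) ⁻¹' s)) := by
    funext E
    have hE : Measurable fun q : Euc n × Euc n =>
        E.starProjection q.1 + (Eᗮ : Subsp n).starProjection q.2 := by fun_prop
    rw [heq, Measure.map_apply hE hs]
    rfl
  rw [this]
  exact measurable_measure_prodMk_left (h hs)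

/-- `μ` is the mixture `∫ (μ_E ⊗ μ_{E^⊥}) dξ(E)`. -/
def IsMixture (μ : Measure (Euc n)) (ξ : Measure (Subsp n)) : Prop :=
  μ = ξ.bind (marginalProd μ)

end SplittingMeasures

/-!
Let `φ` be the characteristic function of `μ`. Call `u ≥ 0` subharmonic if
`u x ≤ ∫ (u (P_E x) + u (P_{Eᗮ} x)) dξ(E)`. If `μ` is a mixture and `g`, like `φ` bounded by `1`,
factors along almost every `E`, then `|φ - g|` is subharmonic. For almost every `E` the splitting
fixes `‖x‖²`, and on the dependent subspace it strictly contracts `‖x‖⁴`, uniformly by compactness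
of the sphere. So a subharmonic function that is `o(‖x‖²)` vanishes there.

The logarithmic moment makes a slight perturbation of `K ‖x‖² - (1 - |φ|)` have subharmonic positive
part, so `1 - |φ|` cannot exceed `K ‖x‖²` on a punctured ball for every `K`; if `μ` splits,
`-log |φ|` is additive and serves instead of `1 - |φ|` without any perturbation. By Fatou's lemma,
`μ` has a finite second moment in some direction; as the set of such directions is invariant under
almost every `P_E`, it contains the whole dependent subspace. The covariance splits because a sum of
squared norms, a trace, has mean zero. A Gaussian `g` with the same first two moments then makes
`φ - g` of order `o(‖x‖²)`, hence zero.

Independence of the components follows in the same way: `|φ - g|`, where `g` is the product of the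
marginal characteristic functions, is dominated by a potential that detects vectors with components
in two different pieces, and splitting contracts this potential too.
-/

namespace SplittingMeasures

open Filter
open scoped RealInnerProductSpace ENNReal Topology

variable {n : ℕ} {ξ : Measure (Subsp n)} {μ : Measure (Euc n)}

section Projections

variable {𝕜 H : Type*} [RCLike 𝕜] [NormedAddCommGroup H] [InnerProductSpace 𝕜 H]
  {E F : Submodule 𝕜 H} [E.HasOrthogonalProjection]

theorem orthogonal_starProjection_mem (h : ∀ z ∈ F, E.starProjection z ∈ F) {z : H}
    (hz : z ∈ F) : Eᗮ.starProjection z ∈ F := by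
  rw [Submodule.starProjection_orthogonal_val]
  exact F.sub_mem hz (h z hz)

theorem starProjection_mem_orthogonal (h : ∀ z ∈ F, E.starProjection z ∈ F) {z : H}
    (hz : z ∈ Fᗮ) : E.starProjection z ∈ Fᗮ := by
  intro w hw
  rw [← E.inner_starProjection_left_eq_right]
  exact hz _ (h w hw)

theorem starProjection_comm_of_mapsTo [F.HasOrthogonalProjection]
    (h : ∀ z ∈ F, E.starProjection z ∈ F) (x : H) :
    F.starProjection (E.starProjection x) = E.starProjection (F.starProjection x) := by
  refine Submodule.eq_starProjection_of_mem_orthogonal (h _ (F.starProjection_apply_mem x)) ?_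
  rw [← map_sub]
  exact starProjection_mem_orthogonal h (F.sub_starProjection_mem_orthogonal x)

theorem starProjection_eq_zero_of_le_orthogonal (h : F ≤ Eᗮ) {x : H} (hx : x ∈ F) :
    E.starProjection x = 0 :=
  (Submodule.starProjection_apply_eq_zero_iff _).2 (h hx)

theorem starProjection_apply_of_le [F.HasOrthogonalProjection] (h : F ≤ E) (x : H) :
    F.starProjection (E.starProjection x) = F.starProjection x ∧
      F.starProjection (Eᗮ.starProjection x) = 0 :=
  ⟨congr($(Submodule.starProjection_comp_starProjection_of_le h) x),
    congr($((Submodule.isOrtho_iff_le.2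
      (h.trans E.le_orthogonal_orthogonal)).starProjection_comp_starProjection) x)⟩

theorem starProjection_apply_of_le_orthogonal [F.HasOrthogonalProjection] (h : F ≤ Eᗮ) (x : H) :
    F.starProjection (E.starProjection x) = 0 ∧
      F.starProjection (Eᗮ.starProjection x) = F.starProjection x := by
  simpa only [Submodule.orthogonal_orthogonal, and_comm] using starProjection_apply_of_le h x

end Projections

theorem charFun_map_starProjection {H : Type*} [NormedAddCommGroup H] [InnerProductSpace ℝ H]
    [MeasurableSpace H] [BorelSpace H] [SecondCountableTopology H] (μ : Measure H)
    (E : Submodule ℝ H) [E.HasOrthogonalProjection] (y : H) :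
    charFun (μ.map E.starProjection) y = charFun μ (E.starProjection y) := by
  rw [charFun_apply, charFun_apply, integral_map (by fun_prop) (by fun_prop)]
  simp_rw [E.inner_starProjection_left_eq_right]

theorem measurable_starProjection_apply (x : Euc n) :
    Measurable fun E : Subsp n => E.starProjection x :=
  (continuous_starProjection_subsp.clm_apply continuous_const).measurable

theorem measurable_orthogonal_starProjection_apply (x : Euc n) :
    Measurable fun E : Subsp n => Eᗮ.starProjection x :=
  (continuous_starProjection_orthogonal_subsp.clm_apply continuous_const).measurable

theorem marginalProd_eq_map (μ : Measure (Euc n)) [IsProbabilityMeasure μ] (E : Subsp n) :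
    marginalProd μ E = (μ.prod μ).map fun q : Euc n × Euc n =>
      E.starProjection q.1 + Eᗮ.starProjection q.2 := by
  unfold marginalProd marginal
  rw [Measure.map_prod_map _ _ (by fun_prop) (by fun_prop),
    Measure.map_map (by fun_prop) (by fun_prop)]
  rfl

instance isProbabilityMeasure_marginal (μ : Measure (Euc n)) [IsProbabilityMeasure μ]
    (E : Subsp n) : IsProbabilityMeasure (marginal μ E) :=
  Measure.isProbabilityMeasure_map (by fun_prop)

instance isProbabilityMeasure_marginalProd (μ : Measure (Euc n)) [IsProbabilityMeasure μ]
    (E : Subsp n) : IsProbabilityMeasure (marginalProd μ E) :=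
  Measure.isProbabilityMeasure_map (by fun_prop)

theorem charFun_marginalProd (μ : Measure (Euc n)) [IsProbabilityMeasure μ] (E : Subsp n)
    (x : Euc n) : charFun (marginalProd μ E) x =
      charFun μ (E.starProjection x) * charFun μ (Eᗮ.starProjection x) := by
  rw [marginalProd_eq_map, charFun_apply, charFun_apply, charFun_apply,
    integral_map (by fun_prop) (by fun_prop), ← integral_prod_mul]
  congr with q
  rw [inner_add_left, E.inner_starProjection_left_eq_right,
    Eᗮ.inner_starProjection_left_eq_right, ← Complex.exp_add]
  push_cast
  ring_nf

/-- `φ` is a product of a function of the component in `E` and a function of the component in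
`Eᗮ`. For characteristic functions this is the independence of the two components. -/
def FactorsAlong (φ : Euc n → ℂ) (E : Subsp n) : Prop :=
  ∀ x, φ x = φ (E.starProjection x) * φ (Eᗮ.starProjection x)

theorem splitsAlong_iff_factorsAlong [IsProbabilityMeasure μ] {E : Subsp n} :
    SplitsAlong μ E ↔ FactorsAlong (charFun μ) E := by
  simp_rw [FactorsAlong, ← charFun_marginalProd]
  exact ⟨fun h x => congrArg (fun ν => charFun ν x) h,
    fun h => Measure.ext_of_charFun (funext h)⟩

theorem SplitsWrt.isMixture [IsProbabilityMeasure μ] [IsProbabilityMeasure ξ]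
    (h : SplitsWrt μ ξ) : IsMixture μ ξ := by
  unfold IsMixture
  ext s hs
  rw [Measure.bind_apply hs (measurable_marginalProd μ).aemeasurable]
  have : (fun E => marginalProd μ E s) =ᵐ[ξ] fun _ => μ s := by
    filter_upwards [h] with E hE
    rw [← hE]
  rw [lintegral_congr_ae this, lintegral_const, measure_univ, mul_one]

theorem isMixture_iff_lintegral [IsProbabilityMeasure μ] :
    IsMixture μ ξ ↔ ∀ f : Euc n → ℝ≥0∞, Measurable f → ∫⁻ x, f x ∂μ =
      ∫⁻ E : Subsp n, ∫⁻ q : Euc n × Euc n,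
        f (E.starProjection q.1 + Eᗮ.starProjection q.2) ∂(μ.prod μ) ∂ξ := by
  have hbind (f : Euc n → ℝ≥0∞) (hf : Measurable f) :
      ∫⁻ x, f x ∂(ξ.bind (marginalProd μ)) = ∫⁻ E : Subsp n, ∫⁻ q : Euc n × Euc n,
        f (E.starProjection q.1 + Eᗮ.starProjection q.2) ∂(μ.prod μ) ∂ξ := by
    rw [Measure.lintegral_bind (measurable_marginalProd μ).aemeasurable hf.aemeasurable]
    refine lintegral_congr fun E => ?_
    rw [marginalProd_eq_map, lintegral_map hf (by fun_prop)]
  unfold IsMixture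
  refine ⟨fun h f hf => (congrArg (fun ν => ∫⁻ x, f x ∂ν) h).trans (hbind f hf),
    fun h => Measure.ext_of_lintegral _ fun f hf => (h f hf).trans (hbind f hf).symm⟩

theorem integrable_charFun_mul_charFun (μ : Measure (Euc n)) [IsProbabilityMeasure μ]
    (ξ : Measure (Subsp n)) [IsProbabilityMeasure ξ] (x : Euc n) :
    Integrable (fun E : Subsp n =>
      charFun μ (E.starProjection x) * charFun μ (Eᗮ.starProjection x)) ξ := by
  refine .of_bound (Measurable.aestronglyMeasurable ?_) 1 (.of_forall fun E => ?_)
  · exact (measurable_charFun.comp (measurable_starProjection_apply x)).mul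
      (measurable_charFun.comp (measurable_orthogonal_starProjection_apply x))
  · rw [norm_mul]
    exact mul_le_one₀ (norm_charFun_le_one _) (norm_nonneg _) (norm_charFun_le_one _)

theorem IsMixture.charFun_eq [IsProbabilityMeasure μ] (h : IsMixture μ ξ) (x : Euc n) :
    charFun μ x =
      ∫ E, charFun μ (E.starProjection x) * charFun μ (Eᗮ.starProjection x) ∂ξ := by
  simp_rw [← charFun_marginalProd]
  let κ : Kernel (Subsp n) (Euc n) := ⟨marginalProd μ, measurable_marginalProd μ⟩
  have hκ : μ = (κ ∘ₖ Kernel.const Unit ξ) () := by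
    rw [Kernel.comp_apply]
    exact h
  conv_lhs => rw [hκ]
  rw [charFun_apply, Kernel.integral_comp]
  · rfl
  · rw [← hκ]
    refine .of_bound (by fun_prop) 1 (.of_forall fun y => ?_)
    exact (Complex.norm_exp_ofReal_mul_I _).le

/-- Almost every subspace `E` splits `F` into `F ⊓ E` and `F ⊓ Eᗮ`. -/
def AEInvariant (ξ : Measure (Subsp n)) (F : Subsp n) : Prop :=
  ∀ᵐ E ∂ξ, ∀ x ∈ F, E.starProjection x ∈ F

theorem AEInvariant.orthogonal {F : Subsp n} (hF : AEInvariant ξ F) : AEInvariant ξ Fᗮ :=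
  hF.mono fun _ hE _ hx => starProjection_mem_orthogonal hE hx

theorem AEInvariant.inf {F G : Subsp n} (hF : AEInvariant ξ F) (hG : AEInvariant ξ G) :
    AEInvariant ξ (F ⊓ G) := by
  filter_upwards [hF, hG] with E hEF hEG x hx using ⟨hEF x hx.1, hEG x hx.2⟩

theorem ae_le_or_le_orthogonal [IsProbabilityMeasure ξ] {F : Subsp n}
    (hF : ∀ x ∈ F, chi ξ x = 0) : ∀ᵐ E ∂ξ, F ≤ E ∨ F ≤ Eᗮ := by
  by_cases hb : F = ⊥
  · exact .of_forall fun E => Or.inl (hb ▸ bot_le)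
  obtain ⟨u, hu, hu0⟩ := Submodule.exists_mem_ne_zero_of_ne_bot hb
  obtain ⟨s, hs⟩ := (IsNoetherian.noetherian F : F.FG)
  have hsF : ∀ v ∈ s, v ∈ F := fun v hv => hs ▸ Submodule.subset_span hv
  have hgen : ∀ᵐ E : Subsp n ∂ξ, ∀ v ∈ s, v ∈ E ∨ v ∈ Eᗮ :=
    (Finset.eventually_all s).2 fun v hv => (chi_eq_zero_iff ξ v).1 (hF v (hsF v hv))
  have hsum : ∀ᵐ E : Subsp n ∂ξ, ∀ v ∈ s, u + v ∈ E ∨ u + v ∈ Eᗮ :=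
    (Finset.eventually_all s).2 fun v hv =>
      (chi_eq_zero_iff ξ _).1 (hF _ (F.add_mem hu (hsF v hv)))
  filter_upwards [hgen, hsum, (chi_eq_zero_iff ξ u).1 (hF u hu)] with E hE hEu hu'
  rw [← hs, Submodule.span_le, Submodule.span_le]
  exact hu'.imp (fun h v hv => same_side hu0 (hE v hv) (hEu v hv) h)
    (fun h v hv => same_side_orthogonal hu0 (hE v hv) (hEu v hv) h)

/-- `E` is compatible with the independent decomposition: every independent subspace lies in `E`
or in `Eᗮ`. This holds for `ξ`-almost every `E`. -/
def Compatible (ξ : Measure (Subsp n)) (E : Subsp n) : Prop :=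
  ∀ F ∈ independentSubspaces ξ, F ≤ E ∨ F ≤ Eᗮ

theorem ae_compatible (ξ : Measure (Subsp n)) [IsProbabilityMeasure ξ] :
    ∀ᵐ E ∂ξ, Compatible ξ E :=
  (ae_ball_iff (Set.toFinite _).countable).2 fun _ hF => ae_le_or_le_orthogonal hF.2.prop

theorem mem_depSubspace_iff {z : Euc n} :
    z ∈ depSubspace ξ ↔ ∀ F ∈ independentSubspaces ξ, z ∈ Fᗮ := by
  simp only [depSubspace, ← Submodule.sInf_orthogonal, Submodule.mem_iInf]

theorem Compatible.starProjection_mem {E F : Subsp n} (h : Compatible ξ E)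
    (hF : F ∈ independentSubspaces ξ) {z : Euc n} (hz : z ∈ F) : E.starProjection z ∈ F := by
  rcases h F hF with hE | hE
  · rwa [Submodule.starProjection_eq_self_iff.2 (hE hz)]
  · rw [starProjection_eq_zero_of_le_orthogonal hE hz]
    exact F.zero_mem

theorem Compatible.starProjection_mem_dep {E : Subsp n} (h : Compatible ξ E) {z : Euc n}
    (hz : z ∈ depSubspace ξ) : E.starProjection z ∈ depSubspace ξ := by
  rw [mem_depSubspace_iff] at hz ⊢
  exact fun F hF => starProjection_mem_orthogonal (fun _ => h.starProjection_mem hF) (hz F hF)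

theorem aeInvariant_depSubspace (ξ : Measure (Subsp n)) [IsProbabilityMeasure ξ] :
    AEInvariant ξ (depSubspace ξ) :=
  (ae_compatible ξ).mono fun _ hE _ => hE.starProjection_mem_dep

theorem chi_ne_zero_of_mem_dep [IsProbabilityMeasure ξ] {z : Euc n}
    (hz : z ∈ depSubspace ξ) (hz0 : z ≠ 0) : chi ξ z ≠ 0 := by
  intro h
  have hmem : z ∈ {x | chi ξ x = 0} := h
  rw [(isIndependentFamily_independentSubspaces ξ).2.2] at hmem
  simp only [Set.mem_union, Set.mem_singleton_iff, hz0, false_or, Set.mem_iUnion,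
    SetLike.mem_coe, exists_prop] at hmem
  obtain ⟨F, hF, hzF⟩ := hmem
  exact hz0 (inner_self_eq_zero.1 (mem_depSubspace_iff.1 hz F hF z hzF))

theorem not_ae_le_iff_le [IsProbabilityMeasure ξ] {F G : Subsp n}
    (hF : F ∈ independentSubspaces ξ) (hG : G ∈ independentSubspaces ξ) (hne : F ≠ G) :
    ¬ ∀ᵐ E ∂ξ, (F ≤ E ↔ G ≤ E) := by
  intro h
  have hsup : ∀ x ∈ F ⊔ G, chi ξ x = 0 := by
    intro x hx
    rw [chi_eq_zero_iff]
    filter_upwards [h, ae_compatible ξ] with E hE hc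
    by_cases hFE : F ≤ E
    · exact Or.inl (sup_le hFE (hE.1 hFE) hx)
    · exact Or.inr (sup_le ((hc F hF).resolve_left hFE)
        ((hc G hG).resolve_left fun hGE => hFE (hE.2 hGE)) hx)
  exact hne ((hF.2.eq_of_le hsup le_sup_left).trans (hG.2.eq_of_le hsup le_sup_right).symm)

open Classical in
/-- The projection onto the side of `F`: onto `E` if `F ≤ E`, and onto `Eᗮ` otherwise. -/
noncomputable def sideProj (F E : Subsp n) : Euc n →L[ℝ] Euc n :=
  if F ≤ E then E.starProjection else Eᗮ.starProjection

theorem measurableSet_setOf_le (F : Subsp n) : MeasurableSet {E : Subsp n | F ≤ E} := by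
  have : {E : Subsp n | F ≤ E} = ⋂ x ∈ F, {E : Subsp n | E.starProjection x = x} := by
    ext E
    simp only [Set.mem_ofPred_eq, Set.mem_iInter, Submodule.starProjection_eq_self_iff]
    rfl
  rw [this]
  refine (isClosed_biInter fun x _ => ?_).measurableSet
  exact isClosed_eq (continuous_starProjection_subsp.clm_apply continuous_const) continuous_const

theorem measurable_sideProj_apply (F : Subsp n) (z : Euc n) :
    Measurable fun E : Subsp n => sideProj F E z := by
  classical
  simp only [sideProj, apply_ite (fun L : Euc n →L[ℝ] Euc n => L z)]
  exact Measurable.ite (measurableSet_setOf_le F) (measurable_starProjection_apply z)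
    (measurable_orthogonal_starProjection_apply z)

theorem norm_sideProj_apply_le (F E : Subsp n) (z : Euc n) : ‖sideProj F E z‖ ≤ ‖z‖ := by
  unfold sideProj
  split_ifs <;> exact Submodule.norm_starProjection_apply_le _ z

theorem mem_or_mem_orthogonal_of_norm_sideProj_eq {F E : Subsp n} {z : Euc n}
    (h : ‖sideProj F E z‖ = ‖z‖) : z ∈ E ∨ z ∈ Eᗮ := by
  unfold sideProj at h
  split_ifs at h
  · exact Or.inl (Submodule.mem_iff_norm_starProjection _ _ |>.2 h)
  · exact Or.inr (Submodule.mem_iff_norm_starProjection _ _ |>.2 h)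

/-! ### The splitting operator -/

/-- The splitting operator `u ↦ ∫ (u (P_E x) + u (P_{Eᗮ} x)) dξ(E)`. A function with
`u ≤ splitOp ξ u` is called subharmonic below. -/
noncomputable def splitOp (ξ : Measure (Subsp n)) (u : Euc n → ℝ≥0∞) (x : Euc n) : ℝ≥0∞ :=
  ∫⁻ E, (u (E.starProjection x) + u (Eᗮ.starProjection x)) ∂ξ

/-- On `D`, the splitting operator shrinks `L` by a factor smaller than `1`. -/
def ContractedOn (ξ : Measure (Subsp n)) (L : Euc n → ℝ≥0∞) (D : Set (Euc n)) : Prop :=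
  ∃ ρ < 1, ∀ x ∈ D, splitOp ξ L x ≤ ρ * L x

theorem ContractedOn.mono {L : Euc n → ℝ≥0∞} {D D' : Set (Euc n)} (h : ContractedOn ξ L D)
    (hD : D' ⊆ D) : ContractedOn ξ L D' :=
  let ⟨ρ, hρ, hL⟩ := h
  ⟨ρ, hρ, fun x hx => hL x (hD hx)⟩

theorem exists_lt_forall_le_of_isCompact {X : Type*} [TopologicalSpace X] {s : Set X}
    (hs : IsCompact s) {f : X → ℝ} (hf : ContinuousOn f s) {a : ℝ} (ha : ∀ x ∈ s, f x < a) :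
    ∃ c < a, ∀ x ∈ s, f x ≤ c := by
  obtain ⟨c, hc, hle⟩ := hs.exists_forall_le' hf.neg (a := -a) fun x hx => neg_lt_neg (ha x hx)
  exact ⟨-c, neg_lt.1 hc, fun x hx => le_neg_of_le_neg (hle x hx)⟩

section Homogeneous

variable {Ω H : Type*} [MeasurableSpace Ω] {P : Measure Ω} [IsProbabilityMeasure P]
  [NormedAddCommGroup H] [NormedSpace ℝ H] [FiniteDimensional ℝ H] {F : Submodule ℝ H} {k : ℕ}
  {f : Ω → H → ℝ}

theorem exists_integral_le_mul_norm_pow (hk : k ≠ 0)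
    (hmeas : ∀ x, AEStronglyMeasurable (fun ω => f ω x) P) (hcont : ∀ ω, Continuous (f ω))
    (hsmul : ∀ ω (c : ℝ) x, 0 ≤ c → f ω (c • x) = c ^ k * f ω x)
    (hf0 : ∀ ω x, 0 ≤ f ω x) (hle : ∀ ω x, f ω x ≤ ‖x‖ ^ k)
    (hne : ∀ x ∈ F, x ≠ 0 → ¬ ∀ᵐ ω ∂P, f ω x = ‖x‖ ^ k) :
    ∃ c < 1, ∀ x ∈ F, ∫ ω, f ω x ∂P ≤ c * ‖x‖ ^ k := by
  have hint (x : H) : Integrable (fun ω => f ω x) P :=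
    .of_bound (hmeas x) (‖x‖ ^ k) (.of_forall fun ω => by
      rw [Real.norm_of_nonneg (hf0 ω x)]
      exact hle ω x)
  have hlt (x : H) (hx : x ∈ (F ∩ Metric.sphere 0 1 : Set H)) : ∫ ω, f ω x ∂P < 1 := by
    have hx1 : ‖x‖ = 1 := mem_sphere_zero_iff_norm.1 hx.2
    have hf1 : (fun ω => f ω x) ≤ᵐ[P] fun _ => 1 :=
      .of_forall fun ω => (hle ω x).trans_eq (by rw [hx1, one_pow])
    have h1 : ∫ _, (1 : ℝ) ∂P = 1 := by simp
    refine lt_of_le_of_ne ((integral_mono_ae (hint x) (integrable_const 1) hf1).trans_eq h1)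
      fun h => hne x hx.1 (by rintro rfl; simp at hx1) ?_
    rw [hx1, one_pow]
    exact (integral_eq_iff_of_ae_le (hint x) (integrable_const 1) hf1).1 (h.trans h1.symm)
  have hcontinuous : ContinuousOn (fun x => ∫ ω, f ω x ∂P) (F ∩ Metric.sphere 0 1) :=
    continuousOn_of_dominated (bound := fun _ => 1) (fun x _ => hmeas x)
      (fun x hx => .of_forall fun ω => by
        rw [Real.norm_of_nonneg (hf0 ω x)]
        exact (hle ω x).trans_eq (by rw [mem_sphere_zero_iff_norm.1 hx.2, one_pow]))
      (integrable_const 1) (.of_forall fun ω => (hcont ω).continuousOn)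
  obtain ⟨c, hc, hmax⟩ :=
    exists_lt_forall_le_of_isCompact
      ((isCompact_sphere 0 1).inter_left F.closed_of_finiteDimensional) hcontinuous hlt
  refine ⟨c, hc, fun x hx => ?_⟩
  rcases eq_or_ne x 0 with rfl | hx0
  · have : ∀ ω, f ω 0 = 0 := fun ω => by simpa [hk] using hsmul ω 0 0 le_rfl
    simp [this, hk]
  · have hsphere : ‖x‖⁻¹ • x ∈ (F ∩ Metric.sphere 0 1 : Set H) :=
      ⟨F.smul_mem _ hx, by simp [norm_smul, hx0]⟩
    calc ∫ ω, f ω x ∂P = ‖x‖ ^ k * ∫ ω, f ω (‖x‖⁻¹ • x) ∂P := by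
          rw [← integral_const_mul]
          simp_rw [← hsmul _ _ _ (norm_nonneg x), smul_inv_smul₀ (norm_ne_zero_iff.2 hx0)]
      _ ≤ ‖x‖ ^ k * c := by gcongr; exact hmax _ hsphere
      _ = c * ‖x‖ ^ k := mul_comm _ _

theorem exists_lintegral_le_mul_enorm_pow (hk : k ≠ 0)
    (hmeas : ∀ x, AEStronglyMeasurable (fun ω => f ω x) P) (hcont : ∀ ω, Continuous (f ω))
    (hsmul : ∀ ω (c : ℝ) x, 0 ≤ c → f ω (c • x) = c ^ k * f ω x)
    (hf0 : ∀ ω x, 0 ≤ f ω x) (hle : ∀ ω x, f ω x ≤ ‖x‖ ^ k)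
    (hne : ∀ x ∈ F, x ≠ 0 → ¬ ∀ᵐ ω ∂P, f ω x = ‖x‖ ^ k) :
    ∃ ρ < 1, ∀ x ∈ F, ∫⁻ ω, ENNReal.ofReal (f ω x) ∂P ≤ ρ * ‖x‖ₑ ^ k := by
  obtain ⟨c, hc, h⟩ := exists_integral_le_mul_norm_pow hk hmeas hcont hsmul hf0 hle hne
  refine ⟨ENNReal.ofReal c, ENNReal.ofReal_lt_one.2 hc, fun x hx => ?_⟩
  have hint : Integrable (fun ω => f ω x) P :=
    .of_bound (hmeas x) (‖x‖ ^ k) (.of_forall fun ω => by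
      rw [Real.norm_of_nonneg (hf0 ω x)]
      exact hle ω x)
  rw [← ofReal_integral_eq_lintegral_ofReal hint (.of_forall fun ω => hf0 ω x), ← ofReal_norm,
    ← ENNReal.ofReal_pow (norm_nonneg x), ← ENNReal.ofReal_mul' (by positivity)]
  exact ENNReal.ofReal_le_ofReal (h x hx)

end Homogeneous

theorem norm_pow_four_eq_starProjection (E : Subsp n) (x : Euc n) :
    ‖x‖ ^ 4 = ‖E.starProjection x‖ ^ 4 + ‖Eᗮ.starProjection x‖ ^ 4 +
      2 * (‖E.starProjection x‖ * ‖Eᗮ.starProjection x‖) ^ 2 := by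
  linear_combination (‖x‖ ^ 2 + ‖E.starProjection x‖ ^ 2 + ‖Eᗮ.starProjection x‖ ^ 2) *
    E.norm_sq_eq_add_norm_sq_starProjection x

theorem mem_or_mem_orthogonal_of_norm_pow_four_eq {E : Subsp n} {x : Euc n}
    (h : ‖E.starProjection x‖ ^ 4 + ‖Eᗮ.starProjection x‖ ^ 4 = ‖x‖ ^ 4) : x ∈ E ∨ x ∈ Eᗮ := by
  have h0 : ‖E.starProjection x‖ * ‖Eᗮ.starProjection x‖ = 0 := by
    rw [norm_pow_four_eq_starProjection E x] at h
    exact pow_eq_zero_iff two_ne_zero |>.1 (by linarith)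
  rcases mul_eq_zero.1 h0 with hE | hE <;>
    rw [norm_eq_zero, Submodule.starProjection_apply_eq_zero_iff] at hE
  · exact Or.inr hE
  · exact Or.inl (E.orthogonal_orthogonal ▸ hE)

theorem contractedOn_enorm_pow_four (ξ : Measure (Subsp n)) [IsProbabilityMeasure ξ] :
    ContractedOn ξ (fun x => ‖x‖ₑ ^ 4) (depSubspace ξ) := by
  let f : Subsp n → Euc n → ℝ := fun E x => ‖E.starProjection x‖ ^ 4 + ‖Eᗮ.starProjection x‖ ^ 4
  have hle (E : Subsp n) (x : Euc n) : f E x ≤ ‖x‖ ^ 4 := by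
    rw [norm_pow_four_eq_starProjection E x]
    exact le_add_of_nonneg_right (by positivity)
  obtain ⟨ρ, hρ, h⟩ := exists_lintegral_le_mul_enorm_pow (P := ξ) (F := depSubspace ξ) (f := f)
    four_ne_zero
    (fun x => (((measurable_starProjection_apply x).norm.pow_const 4).add
      ((measurable_orthogonal_starProjection_apply x).norm.pow_const 4)).aestronglyMeasurable)
    (fun E => by fun_prop)
    (fun E c x hc => by
      simp only [f, map_smul, norm_smul, Real.norm_of_nonneg hc]
      ring)
    (fun E x => by positivity) hle
    fun x hx hx0 hae => chi_ne_zero_of_mem_dep hx hx0 <| (chi_eq_zero_iff ξ x).2 <|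
      hae.mono fun E => mem_or_mem_orthogonal_of_norm_pow_four_eq
  refine ⟨ρ, hρ, fun x hx => (lintegral_congr fun E => ?_).trans_le (h x hx)⟩
  rw [ENNReal.ofReal_add (by positivity) (by positivity), ENNReal.ofReal_pow (norm_nonneg _),
    ENNReal.ofReal_pow (norm_nonneg _), ofReal_norm, ofReal_norm]

theorem exists_lintegral_sideProj_le (ξ : Measure (Subsp n)) [IsProbabilityMeasure ξ]
    (F : Subsp n) : ∃ ρ < 1, ∀ z ∈ depSubspace ξ, ∫⁻ E, ‖sideProj F E z‖ₑ ∂ξ ≤ ρ * ‖z‖ₑ := by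
  obtain ⟨ρ, hρ, h⟩ := exists_lintegral_le_mul_enorm_pow (P := ξ) (F := depSubspace ξ)
    (f := fun E z => ‖sideProj F E z‖) one_ne_zero
    (fun z => (measurable_sideProj_apply F z).norm.aestronglyMeasurable)
    (fun E => by fun_prop) (fun E c z hc => by simp [norm_smul, abs_of_nonneg hc])
    (fun E z => norm_nonneg _) (fun E z => by rw [pow_one]; exact norm_sideProj_apply_le F E z)
    fun z hz hz0 hae => chi_ne_zero_of_mem_dep hz hz0 <| (chi_eq_zero_iff ξ z).2 <|
      hae.mono fun E hE => mem_or_mem_orthogonal_of_norm_sideProj_eq (by rwa [pow_one] at hE)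
  exact ⟨ρ, hρ, fun z hz => by simpa only [ofReal_norm, pow_one] using h z hz⟩

/-- The splitting operator does not lead out of `D`. -/
def SplitInvariant (ξ : Measure (Subsp n)) (D : Set (Euc n)) : Prop :=
  ∀ x ∈ D, ∀ᵐ E : Subsp n ∂ξ, E.starProjection x ∈ D ∧ Eᗮ.starProjection x ∈ D

theorem AEInvariant.splitInvariant_inter_closedBall {F : Subsp n} (hF : AEInvariant ξ F)
    (r : ℝ) : SplitInvariant ξ (F ∩ Metric.closedBall 0 r) := by
  intro x hx
  have hxr := mem_closedBall_zero_iff.1 hx.2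
  filter_upwards [hF] with E hE
  simp only [Set.mem_inter_iff, SetLike.mem_coe, mem_closedBall_zero_iff]
  exact ⟨⟨hE x hx.1, (E.norm_starProjection_apply_le x).trans hxr⟩,
    orthogonal_starProjection_mem hE hx.1, (Eᗮ.norm_starProjection_apply_le x).trans hxr⟩

theorem le_of_subharmonic {D : Set (Euc n)} (hD : SplitInvariant ξ D)
    {u N L : Euc n → ℝ≥0∞} {C : ℝ≥0∞} (hNm : Measurable N)
    (hN : ∀ x ∈ D, splitOp ξ N x ≤ N x) (hL : ContractedOn ξ L D) (hLtop : ∀ x ∈ D, L x ≠ ∞)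
    (hu : ∀ x ∈ D, u x ≤ splitOp ξ u x) (hC : C ≠ ∞) (hle : ∀ x ∈ D, u x ≤ N x + C * L x) :
    ∀ x ∈ D, u x ≤ N x := by
  obtain ⟨ρ, hρ, hL⟩ := hL
  have hiterate (k : ℕ) : ∀ x ∈ D, u x ≤ N x + ρ ^ k * C * L x := by
    induction k with
    | zero => simpa using hle
    | succ k ih =>
      intro x hx
      have hCk : ρ ^ k * C ≠ ∞ :=
        ENNReal.mul_ne_top (ENNReal.pow_ne_top (hρ.trans ENNReal.one_lt_top).ne) hC
      have hNmx : Measurable fun E : Subsp n =>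
          N (E.starProjection x) + N (Eᗮ.starProjection x) :=
        (hNm.comp (measurable_starProjection_apply x)).add
          (hNm.comp (measurable_orthogonal_starProjection_apply x))
      calc u x ≤ splitOp ξ u x := hu x hx
        _ ≤ ∫⁻ E : Subsp n, ((N (E.starProjection x) + N (Eᗮ.starProjection x)) +
            ρ ^ k * C * (L (E.starProjection x) + L (Eᗮ.starProjection x))) ∂ξ := by
          refine lintegral_mono_ae ?_
          filter_upwards [hD x hx] with E hE
          refine (add_le_add (ih _ hE.1) (ih _ hE.2)).trans_eq ?_
          ring
        _ = splitOp ξ N x + ρ ^ k * C * splitOp ξ L x := by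
          rw [lintegral_add_left hNmx, lintegral_const_mul' _ _ hCk]
          rfl
        _ ≤ N x + ρ ^ k * C * (ρ * L x) := by gcongr; exacts [hN x hx, hL x hx]
        _ = N x + ρ ^ (k + 1) * C * L x := by ring
  intro x hx
  have hlim : Tendsto (fun k : ℕ => N x + ρ ^ k * (C * L x)) atTop (𝓝 (N x + 0 * (C * L x))) :=
    tendsto_const_nhds.add (ENNReal.Tendsto.mul_const
      (ENNReal.tendsto_pow_atTop_nhds_zero_of_lt_one hρ)
      (Or.inr (ENNReal.mul_ne_top hC (hLtop x hx))))
  rw [zero_mul, add_zero] at hlim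
  exact ge_of_tendsto' hlim fun k => by rw [← mul_assoc]; exact hiterate k x hx

/-! ### Quadratic lower bounds for the characteristic function -/

/-- `1 - |φ|` is at most quadratic along some sequence of nonzero vectors of `F` tending to `0`. -/
def QuadraticAlongSequence (μ : Measure (Euc n)) (F : Subsp n) : Prop :=
  ∃ K : ℝ, ∃ᶠ y in 𝓝[F \ {0}] 0, 1 - ‖charFun μ y‖ ≤ K * ‖y‖ ^ 2

theorem exists_mem_ne_zero_norm_le {H : Type*} [NormedAddCommGroup H] [NormedSpace ℝ H]
    {F : Submodule ℝ H} (hF : F ≠ ⊥) {r : ℝ} (hr : 0 < r) : ∃ x ∈ F, x ≠ 0 ∧ ‖x‖ ≤ r := by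
  obtain ⟨v, hv, hv0⟩ := Submodule.exists_mem_ne_zero_of_ne_bot hF
  have hn : ‖v‖ ≠ 0 := norm_ne_zero_iff.2 hv0
  refine ⟨(r * ‖v‖⁻¹) • v, F.smul_mem _ hv, smul_ne_zero (by positivity) hv0, ?_⟩
  rw [norm_smul, Real.norm_of_nonneg (by positivity), inv_mul_cancel_right₀ hn]

theorem le_of_posPart_subharmonic [IsProbabilityMeasure ξ] {F : Subsp n}
    (hF : F ≤ depSubspace ξ) (hinv : AEInvariant ξ F) {r K : ℝ} (hK : 0 ≤ K) {w h : Euc n → ℝ}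
    (hh : ∀ x ∈ F, ‖x‖ ≤ r → 0 ≤ h x) (hw : ∀ x ∈ F, ‖x‖ ≤ r → w x ≤ K * ‖x‖ ^ 2)
    (hsmall : ∀ᶠ x in 𝓝[F] 0, w x ≤ h x)
    (hu : ∀ x ∈ F, ‖x‖ ≤ r →
      ENNReal.ofReal (w x - h x) ≤ splitOp ξ (fun y => ENNReal.ofReal (w y - h y)) x) :
    ∀ x ∈ F, ‖x‖ ≤ r → w x ≤ h x := by
  obtain ⟨δ, hδ, hsmall⟩ := Metric.nhdsWithin_basis_ball.eventually_iff.1 hsmall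
  have hle : ∀ x ∈ (F ∩ Metric.closedBall 0 r : Set (Euc n)),
      ENNReal.ofReal (w x - h x) ≤ 0 + ENNReal.ofReal (K / δ ^ 2) * ‖x‖ₑ ^ 4 := by
    rintro x ⟨hx, hxr⟩
    rw [mem_closedBall_zero_iff] at hxr
    rcases lt_or_ge ‖x‖ δ with hxδ | hxδ
    · rw [ENNReal.ofReal_of_nonpos (sub_nonpos.2 (hsmall ⟨by simpa using hxδ, hx⟩))]
      exact zero_le
    · rw [zero_add, ← ofReal_norm, ← ENNReal.ofReal_pow (norm_nonneg _),
        ← ENNReal.ofReal_mul (by positivity)]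
      refine ENNReal.ofReal_le_ofReal ?_
      calc w x - h x ≤ K * ‖x‖ ^ 2 * 1 := by linarith [hw x hx hxr, hh x hx hxr]
        _ ≤ K * ‖x‖ ^ 2 * (‖x‖ ^ 2 / δ ^ 2) := by
          gcongr
          rw [one_le_div (by positivity)]
          gcongr
        _ = K / δ ^ 2 * ‖x‖ ^ 4 := by ring
  have hzero := le_of_subharmonic (hinv.splitInvariant_inter_closedBall r) (N := fun _ => 0)
    measurable_const (fun x _ => by simp [splitOp])
    ((contractedOn_enorm_pow_four ξ).mono fun x hx => hF hx.1) (fun x _ => by simp)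
    (fun x hx => hu x hx.1 (mem_closedBall_zero_iff.1 hx.2)) ENNReal.ofReal_ne_top hle
  intro x hx hxr
  simpa using hzero x ⟨hx, mem_closedBall_zero_iff.2 hxr⟩

theorem quadraticAlongSequence_of_subharmonic [IsProbabilityMeasure μ] [IsProbabilityMeasure ξ]
    {F : Subsp n} (hF : F ≤ depSubspace ξ) (hinv : AEInvariant ξ F) {r K : ℝ} (hK : 0 ≤ K)
    {W h : Euc n → ℝ} (hW : ∀ y, W y ≤ 1)
    (hh : ∀ y ∈ F, ‖y‖ ≤ r → 1 - ‖charFun μ y‖ ≤ h y)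
    (hu : ∀ y ∈ F, ‖y‖ ≤ r → ENNReal.ofReal (K * ‖y‖ ^ 2 * W y - h y) ≤
      splitOp ξ (fun z => ENNReal.ofReal (K * ‖z‖ ^ 2 * W z - h z)) y)
    {x : Euc n} (hx : x ∈ F) (hx0 : x ≠ 0) (hxr : ‖x‖ ≤ r) (hlt : h x < K * ‖x‖ ^ 2 * W x) :
    QuadraticAlongSequence μ F := by
  by_contra hcon
  simp only [QuadraticAlongSequence, not_exists, not_frequently, not_le] at hcon
  have hφ (y : Euc n) : 0 ≤ 1 - ‖charFun μ y‖ := sub_nonneg.2 (norm_charFun_le_one y)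
  have hWK (y : Euc n) : K * ‖y‖ ^ 2 * W y ≤ K * ‖y‖ ^ 2 :=
    mul_le_of_le_one_right (by positivity) (hW y)
  have hball : ∀ᶠ y in 𝓝[F] (0 : Euc n), y ∈ F ∧ ‖y‖ ≤ r := by
    filter_upwards [self_mem_nhdsWithin, nhdsWithin_le_nhds
      (Metric.closedBall_mem_nhds 0 ((norm_pos_iff.2 hx0).trans_le hxr))] with y hy hyr
    exact ⟨hy, mem_closedBall_zero_iff.1 hyr⟩
  have hsmall : ∀ᶠ y in 𝓝[F] (0 : Euc n), K * ‖y‖ ^ 2 * W y ≤ h y := by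
    have hcon' := hcon K
    rw [Set.sdiff_eq, nhdsWithin_inter', eventually_inf_principal] at hcon'
    filter_upwards [hcon', hball] with y hy hyF
    rcases eq_or_ne y 0 with rfl | hy0
    · simpa using (hφ 0).trans (hh 0 hyF.1 hyF.2)
    · exact (hWK y).trans ((hy hy0).le.trans (hh y hyF.1 hyF.2))
  exact hlt.not_ge <| le_of_posPart_subharmonic hF hinv hK
    (fun y hy hyr => (hφ y).trans (hh y hy hyr)) (fun y _ _ => hWK y) hsmall hu x hx hxr

theorem exists_forall_norm_le_charFun_ne_zero (μ : Measure (Euc n)) [IsProbabilityMeasure μ] :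
    ∃ r > 0, ∀ x : Euc n, ‖x‖ ≤ r → charFun μ x ≠ 0 := by
  have h : ∀ᶠ x in 𝓝 (0 : Euc n), charFun μ x ≠ 0 :=
    continuous_charFun.continuousAt.eventually_ne (by simp)
  obtain ⟨r, hr, hball⟩ := Metric.nhds_basis_closedBall.eventually_iff.1 h
  exact ⟨r, hr, fun x hx => hball (mem_closedBall_zero_iff.2 hx)⟩

theorem SplitsWrt.quadraticAlongSequence [IsProbabilityMeasure μ] [IsProbabilityMeasure ξ]
    (h : SplitsWrt μ ξ) {F : Subsp n} (hF : F ≤ depSubspace ξ) (hinv : AEInvariant ξ F)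
    (hF0 : F ≠ ⊥) : QuadraticAlongSequence μ F := by
  obtain ⟨r, hr, hφ⟩ := exists_forall_norm_le_charFun_ne_zero μ
  obtain ⟨x, hx, hx0, hxr⟩ := exists_mem_ne_zero_norm_le hF0 hr
  let g : Euc n → ℝ := fun y => -Real.log ‖charFun μ y‖
  have hg0 : 0 ≤ g x := neg_nonneg.2 (Real.log_nonpos (norm_nonneg _) (norm_charFun_le_one x))
  refine quadraticAlongSequence_of_subharmonic hF hinv (K := (g x + 1) / ‖x‖ ^ 2)
    (W := fun _ => 1) (h := g) (by positivity) (fun _ => le_rfl) (fun y _ hyr => ?_)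
    (fun y _ hyr => ?_) hx hx0 hxr ?_
  · linarith [Real.log_le_sub_one_of_pos (norm_pos_iff.2 (hφ y hyr))]
  · set K := (g x + 1) / ‖x‖ ^ 2
    calc ENNReal.ofReal (K * ‖y‖ ^ 2 * 1 - g y)
      _ = ∫⁻ _ : Subsp n, ENNReal.ofReal (K * ‖y‖ ^ 2 * 1 - g y) ∂ξ := by simp
      _ ≤ splitOp ξ (fun z => ENNReal.ofReal (K * ‖z‖ ^ 2 * 1 - g z)) y := by
        refine lintegral_mono_ae ?_
        filter_upwards [h] with E hE
        have hadd : g y = g (E.starProjection y) + g (Eᗮ.starProjection y) := by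
          simp only [g]
          rw [splitsAlong_iff_factorsAlong.1 hE y, norm_mul, Real.log_mul, neg_add]
          · exact norm_ne_zero_iff.2 (hφ _ ((E.norm_starProjection_apply_le y).trans hyr))
          · exact norm_ne_zero_iff.2 (hφ _ ((Eᗮ.norm_starProjection_apply_le y).trans hyr))
        refine le_trans (ENNReal.ofReal_le_ofReal ?_) ENNReal.ofReal_add_le
        rw [E.norm_sq_eq_add_norm_sq_starProjection y, hadd]
        linarith
  · rw [mul_one, div_mul_cancel₀ _ (by positivity)]
    exact lt_add_one _

section LogMoment

variable {Ω H : Type*} [MeasurableSpace Ω] {P : Measure Ω} [NormedAddCommGroup H] {f : Ω → H}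

/-- The logarithmic moment of `f` at scale `r`. -/
noncomputable def logMoment (P : Measure Ω) (f : Ω → H) (r : ℝ) : ℝ :=
  ∫ ω, Real.log (1 + r * ‖f ω‖) ∂P

theorem logMoment_nonneg {r : ℝ} (hr : 0 ≤ r) : 0 ≤ logMoment P f r :=
  integral_nonneg fun ω => Real.log_nonneg (le_add_of_nonneg_right (by positivity))

theorem norm_log_one_add_mul_le {r t : ℝ} (hr : r ∈ Set.Icc 0 1) (ht : 0 ≤ t) :
    ‖Real.log (1 + r * t)‖ ≤ Real.log (1 + t) := by
  have hrt : 0 ≤ r * t := mul_nonneg hr.1 ht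
  rw [Real.norm_of_nonneg (Real.log_nonneg (le_add_of_nonneg_right hrt))]
  exact Real.log_le_log (by positivity) (by gcongr; exact mul_le_of_le_one_left ht hr.2)

theorem aestronglyMeasurable_log_one_add_mul (hf : AEStronglyMeasurable f P) (r : ℝ) :
    AEStronglyMeasurable (fun ω => Real.log (1 + r * ‖f ω‖)) P :=
  (Real.measurable_log.comp_aemeasurable
    ((hf.norm.aemeasurable.const_mul r).const_add 1)).aestronglyMeasurable

theorem integrable_log_one_add_mul (hf : AEStronglyMeasurable f P)
    (hlog : Integrable (fun ω => Real.log (1 + ‖f ω‖)) P) {r : ℝ} (hr : r ∈ Set.Icc 0 1) :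
    Integrable (fun ω => Real.log (1 + r * ‖f ω‖)) P :=
  hlog.mono' (aestronglyMeasurable_log_one_add_mul hf r)
    (.of_forall fun _ => norm_log_one_add_mul_le hr (norm_nonneg _))

theorem monotoneOn_logMoment (hf : AEStronglyMeasurable f P)
    (hlog : Integrable (fun ω => Real.log (1 + ‖f ω‖)) P) :
    MonotoneOn (logMoment P f) (Set.Icc 0 1) := by
  intro s hs r hr hsr
  refine integral_mono (integrable_log_one_add_mul hf hlog hs)
    (integrable_log_one_add_mul hf hlog hr) fun ω => ?_
  have := mul_nonneg hs.1 (norm_nonneg (f ω))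
  exact Real.log_le_log (by positivity) (by gcongr)

theorem tendsto_logMoment_nhdsGT_zero (hf : AEStronglyMeasurable f P)
    (hlog : Integrable (fun ω => Real.log (1 + ‖f ω‖)) P) :
    Tendsto (logMoment P f) (𝓝[>] 0) (𝓝 0) := by
  suffices h : Tendsto (logMoment P f) (𝓝[>] 0) (𝓝 (∫ ω, Real.log (1 + 0 * ‖f ω‖) ∂P)) by
    simpa using h
  refine tendsto_integral_filter_of_dominated_convergence _
    (.of_forall (aestronglyMeasurable_log_one_add_mul hf)) ?_ hlog (.of_forall fun ω => ?_)
  · filter_upwards [Ioc_mem_nhdsGT one_pos] with r hr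
    exact .of_forall fun ω => norm_log_one_add_mul_le (Set.Ioc_subset_Icc_self hr) (norm_nonneg _)
  · have : ContinuousAt (fun r : ℝ => Real.log (1 + r * ‖f ω‖)) 0 :=
      ContinuousAt.log (by fun_prop) (by simp)
    exact this.tendsto.mono_left nhdsWithin_le_nhds

end LogMoment

theorem div_one_add_le_log_sub_log {s t : ℝ} (hs : 0 ≤ s) (hst : 4 * s ≤ 3 * t) :
    t / (1 + t) ≤ 4 * (Real.log (1 + t) - Real.log (1 + s)) := by
  have ht : 0 ≤ t := by linarith
  have hlog : Real.log (1 + s) - Real.log (1 + t) ≤ (1 + s) / (1 + t) - 1 := by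
    rw [← Real.log_div (by positivity) (by positivity)]
    exact Real.log_le_sub_one_of_pos (by positivity)
  calc t / (1 + t) ≤ 4 * (t - s) / (1 + t) := by gcongr; linarith
    _ = 4 * (1 - (1 + s) / (1 + t)) := by field_simp; ring
    _ ≤ 4 * (Real.log (1 + t) - Real.log (1 + s)) := by linarith

theorem min_two_le_div_one_add {t : ℝ} (ht : 0 ≤ t) : min 2 t ≤ 3 * (t / (1 + t)) := by
  rw [← mul_div_assoc, le_div_iff₀ (by positivity)]
  rcases le_total t 2 with h | h
  · rw [min_eq_right h]; nlinarith
  · rw [min_eq_left h]; linarith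

theorem norm_one_sub_cexp_le_log_sub_log {θ s t : ℝ} (hθ : |θ| ≤ t) (hs : 0 ≤ s)
    (hst : 4 * s ≤ 3 * t) :
    ‖1 - Complex.exp (θ * Complex.I)‖ ≤ 12 * (Real.log (1 + t) - Real.log (1 + s)) := by
  have hmin : ‖1 - Complex.exp (θ * Complex.I)‖ ≤ min 2 t := by
    refine le_min ((norm_sub_le _ _).trans ?_) ?_
    · rw [Complex.norm_exp_ofReal_mul_I, norm_one]
      norm_num
    · rw [norm_sub_rev, mul_comm]
      exact Real.norm_exp_I_mul_ofReal_sub_one_le.trans hθ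
  linarith [min_two_le_div_one_add (t := t) (by linarith), div_one_add_le_log_sub_log hs hst]

theorem one_sub_norm_charFun_le_logMoment_sub {H : Type*} [NormedAddCommGroup H]
    [InnerProductSpace ℝ H] [MeasurableSpace H] [BorelSpace H] [SecondCountableTopology H]
    {μ : Measure H} [IsProbabilityMeasure μ] {V : Submodule ℝ H} [V.HasOrthogonalProjection]
    (hlog : Integrable (fun X => Real.log (1 + ‖V.starProjection X‖)) μ)
    {y : H} (hy : y ∈ V) {s r : ℝ} (hs : 0 ≤ s) (hsr : 4 * s ≤ 3 * r) (hyr : ‖y‖ ≤ r)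
    (hr1 : r ≤ 1) : 1 - ‖charFun μ y‖ ≤
      12 * (logMoment μ V.starProjection r - logMoment μ V.starProjection s) := by
  have hmeas : AEStronglyMeasurable V.starProjection μ := by fun_prop
  have hir := integrable_log_one_add_mul hmeas hlog (r := r) ⟨by linarith, hr1⟩
  have his := integrable_log_one_add_mul hmeas hlog (r := s) ⟨hs, by linarith⟩
  have hexp : Integrable (fun X => Complex.exp (⟪X, y⟫ * Complex.I)) μ :=
    .of_bound (by fun_prop) 1 (.of_forall fun X => (Complex.norm_exp_ofReal_mul_I _).le)
  have hinner (X : H) : |⟪X, y⟫| ≤ r * ‖V.starProjection X‖ := by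
    rw [← Submodule.starProjection_eq_self_iff.2 hy, ← V.inner_starProjection_left_eq_right]
    calc |⟪V.starProjection X, y⟫| ≤ ‖V.starProjection X‖ * ‖y‖ := abs_real_inner_le_norm _ _
      _ ≤ ‖V.starProjection X‖ * r := by gcongr
      _ = r * ‖V.starProjection X‖ := mul_comm _ _
  calc 1 - ‖charFun μ y‖ ≤ ‖1 - charFun μ y‖ := by simpa using norm_sub_norm_le 1 (charFun μ y)
    _ = ‖∫ X, (1 - Complex.exp (⟪X, y⟫ * Complex.I)) ∂μ‖ := by
      rw [integral_sub (integrable_const _) hexp, ← charFun_apply]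
      simp
    _ ≤ ∫ X, 12 * (Real.log (1 + r * ‖V.starProjection X‖) -
          Real.log (1 + s * ‖V.starProjection X‖)) ∂μ :=
      norm_integral_le_of_norm_le ((hir.sub his).const_mul 12) (.of_forall fun X =>
        norm_one_sub_cexp_le_log_sub_log (hinner X) (by positivity) (by
          nlinarith [norm_nonneg (V.starProjection X)]))
    _ = 12 * (logMoment μ V.starProjection r - logMoment μ V.starProjection s) := by
      rw [integral_const_mul, integral_sub hir his]
      rfl

theorem ofReal_integral_le_lintegral_ofReal {Ω : Type*} [MeasurableSpace Ω] {P : Measure Ω}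
    {f : Ω → ℝ} (hf : Integrable f P) :
    ENNReal.ofReal (∫ ω, f ω ∂P) ≤ ∫⁻ ω, ENNReal.ofReal (f ω) ∂P := by
  rw [integral_eq_lintegral_pos_part_sub_lintegral_neg_part hf]
  exact (ENNReal.ofReal_le_ofReal (sub_le_self _ ENNReal.toReal_nonneg)).trans
    ENNReal.ofReal_toReal_le

theorem IsMixture.ofReal_sub_le_lintegral [IsProbabilityMeasure μ] [IsProbabilityMeasure ξ]
    (h : IsMixture μ ξ) (c : ℝ) (y : Euc n) :
    ENNReal.ofReal (c - (1 - ‖charFun μ y‖)) ≤ ∫⁻ E : Subsp n, ENNReal.ofReal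
      (c - (1 - ‖charFun μ (E.starProjection y)‖ * ‖charFun μ (Eᗮ.starProjection y)‖)) ∂ξ := by
  have hint := (integrable_charFun_mul_charFun μ ξ y).norm
  simp_rw [norm_mul] at hint
  have hint1 : Integrable (fun E : Subsp n =>
      1 - ‖charFun μ (E.starProjection y)‖ * ‖charFun μ (Eᗮ.starProjection y)‖) ξ :=
    (integrable_const 1).sub hint
  refine le_trans (ENNReal.ofReal_le_ofReal ?_) (ofReal_integral_le_lintegral_ofReal
    ((integrable_const c).sub hint1))
  rw [integral_sub (integrable_const c) hint1, integral_sub (integrable_const 1) hint]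
  simp only [integral_const, probReal_univ, one_smul]
  gcongr
  rw [h.charFun_eq y]
  simp_rw [← norm_mul]
  exact norm_integral_le_integral_norm _

/-- The factor that makes `‖y‖²` strict enough a subsolution to absorb the cross term
`(1 - |φ(a)|) (1 - |φ(b)|)` between the two pieces of `y`. -/
noncomputable def logWeight (μ : Measure (Euc n)) (V : Subsp n) (y : Euc n) : ℝ :=
  1 - 12 * logMoment μ V.starProjection ‖y‖

theorem logWeight_le_one (V : Subsp n) (y : Euc n) : logWeight μ V y ≤ 1 := by
  have := logMoment_nonneg (P := μ) (f := V.starProjection) (norm_nonneg y)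
  simp only [logWeight]
  linarith

theorem ofReal_sub_le_ofReal_sub_add_ofReal_sub {α β w wa wb ga gb : ℝ} (hα : 0 ≤ α)
    (hβ : 0 ≤ β) (hga0 : 0 ≤ ga) (hga1 : ga ≤ 1) (hwb : wb ≤ 1) (hwa : w ≤ wa)
    (hga : ga ≤ wb - w) : ENNReal.ofReal ((α + β) * w - (1 - (1 - ga) * (1 - gb))) ≤
      ENNReal.ofReal (α * wa - ga) + ENNReal.ofReal (β * wb - gb) := by
  have hw : w ≤ (1 - ga) * wb := by nlinarith
  have hle : (α + β) * w - (1 - (1 - ga) * (1 - gb)) ≤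
      (α * wa - ga) + (1 - ga) * (β * wb - gb) := by
    nlinarith [mul_le_mul_of_nonneg_left hwa hα, mul_le_mul_of_nonneg_left hw hβ]
  calc ENNReal.ofReal ((α + β) * w - (1 - (1 - ga) * (1 - gb)))
    _ ≤ ENNReal.ofReal (α * wa - ga) + ENNReal.ofReal ((1 - ga) * (β * wb - gb)) :=
      (ENNReal.ofReal_le_ofReal hle).trans ENNReal.ofReal_add_le
    _ ≤ ENNReal.ofReal (α * wa - ga) + ENNReal.ofReal (β * wb - gb) := by
      rw [ENNReal.ofReal_mul (sub_nonneg.2 hga1)]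
      gcongr
      exact mul_le_of_le_one_left zero_le (ENNReal.ofReal_le_one.2 (by linarith))

section LogWeight

variable {V : Subsp n} [IsProbabilityMeasure μ]

theorem ofReal_logWeight_sub_le_of_norm_le
    (hlog : Integrable (fun X => Real.log (1 + ‖V.starProjection X‖)) μ) {K : ℝ} (hK : 0 ≤ K)
    {y a b : Euc n} (ha : a ∈ V) (hab : ‖y‖ ^ 2 = ‖a‖ ^ 2 + ‖b‖ ^ 2) (hy : ‖y‖ ≤ 1)
    (hba : ‖b‖ ≤ ‖a‖) : ENNReal.ofReal (K * ‖y‖ ^ 2 * logWeight μ V y -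
        (1 - ‖charFun μ a‖ * ‖charFun μ b‖)) ≤
      ENNReal.ofReal (K * ‖a‖ ^ 2 * logWeight μ V a - (1 - ‖charFun μ a‖)) +
        ENNReal.ofReal (K * ‖b‖ ^ 2 * logWeight μ V b - (1 - ‖charFun μ b‖)) := by
  have hay : ‖a‖ ≤ ‖y‖ := by
    refine le_of_sq_le_sq ?_ (norm_nonneg y)
    linarith [sq_nonneg ‖b‖]
  have hby : 4 * ‖b‖ ≤ 3 * ‖y‖ := by
    refine le_of_sq_le_sq ?_ (by positivity)
    nlinarith [pow_le_pow_left₀ (norm_nonneg b) hba 2, sq_nonneg ‖b‖]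
  have hmono : logMoment μ V.starProjection ‖a‖ ≤ logMoment μ V.starProjection ‖y‖ :=
    monotoneOn_logMoment (by fun_prop) hlog ⟨norm_nonneg a, hay.trans hy⟩ ⟨norm_nonneg y, hy⟩ hay
  have hφa := one_sub_norm_charFun_le_logMoment_sub hlog ha (norm_nonneg b) hby hay hy
  have := ofReal_sub_le_ofReal_sub_add_ofReal_sub (α := K * ‖a‖ ^ 2) (β := K * ‖b‖ ^ 2)
    (w := logWeight μ V y) (wa := logWeight μ V a) (gb := 1 - ‖charFun μ b‖) (by positivity)
    (by positivity) (sub_nonneg.2 (norm_charFun_le_one a)) (sub_le_self _ (norm_nonneg _))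
    (logWeight_le_one V b) (by simp only [logWeight]; linarith)
    (by simp only [logWeight]; linarith)
  simpa only [hab, mul_add, sub_sub_cancel] using this

theorem IsMixture.ofReal_logWeight_sub_le_splitOp [IsProbabilityMeasure ξ] (h : IsMixture μ ξ)
    (hlog : Integrable (fun X => Real.log (1 + ‖V.starProjection X‖)) μ)
    (hV : AEInvariant ξ V) {K : ℝ} (hK : 0 ≤ K) {y : Euc n} (hyV : y ∈ V) (hy : ‖y‖ ≤ 1) :
    ENNReal.ofReal (K * ‖y‖ ^ 2 * logWeight μ V y - (1 - ‖charFun μ y‖)) ≤ splitOp ξ (fun z =>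
      ENNReal.ofReal (K * ‖z‖ ^ 2 * logWeight μ V z - (1 - ‖charFun μ z‖))) y := by
  refine (h.ofReal_sub_le_lintegral _ y).trans (lintegral_mono_ae ?_)
  filter_upwards [hV] with E hE
  have hpyth := E.norm_sq_eq_add_norm_sq_starProjection y
  rcases le_total ‖Eᗮ.starProjection y‖ ‖E.starProjection y‖ with hle | hle
  · exact ofReal_logWeight_sub_le_of_norm_le hlog hK (hE y hyV) hpyth hy hle
  · rw [mul_comm ‖charFun μ _‖, add_comm (ENNReal.ofReal _)]
    exact ofReal_logWeight_sub_le_of_norm_le hlog hK (orthogonal_starProjection_mem hE hyV)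
      (hpyth.trans (add_comm _ _)) hy hle

theorem IsMixture.quadraticAlongSequence [IsProbabilityMeasure ξ] (h : IsMixture μ ξ)
    (hlog : Integrable (fun X => Real.log (1 + ‖(depSubspace ξ).starProjection X‖)) μ)
    {F : Subsp n} (hF : F ≤ depSubspace ξ) (hinv : AEInvariant ξ F) (hF0 : F ≠ ⊥) :
    QuadraticAlongSequence μ F := by
  obtain ⟨r, hsmall, hr⟩ : ∃ r, logMoment μ (depSubspace ξ).starProjection r ≤ 1 / 24 ∧
      r ∈ Set.Ioc 0 1 :=
    (((tendsto_logMoment_nhdsGT_zero (by fun_prop) hlog).eventually_le_const (by norm_num)).and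
      (Ioc_mem_nhdsGT one_pos)).exists
  obtain ⟨x, hx, hx0, hxr⟩ := exists_mem_ne_zero_norm_le hF0 hr.1
  refine quadraticAlongSequence_of_subharmonic hF hinv (K := 4 / ‖x‖ ^ 2) (by positivity)
    (logWeight_le_one _) (fun _ _ _ => le_rfl)
    (fun y hy hyr => h.ofReal_logWeight_sub_le_splitOp hlog (aeInvariant_depSubspace ξ)
      (by positivity) (hF hy) (hyr.trans hr.2)) hx hx0 hxr ?_
  have hweight : 1 / 2 ≤ logWeight μ (depSubspace ξ) x := by
    have : logMoment μ (depSubspace ξ).starProjection ‖x‖ ≤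
        logMoment μ (depSubspace ξ).starProjection r :=
      monotoneOn_logMoment (by fun_prop) hlog ⟨norm_nonneg x, hxr.trans hr.2⟩
        (Set.Ioc_subset_Icc_self hr) hxr
    simp only [logWeight]
    linarith
  rw [div_mul_cancel₀ _ (by positivity)]
  linarith [norm_nonneg (charFun μ x)]

end LogWeight

/-! ### Finite second moments on the dependent subspace -/

section SecondMoment

variable {H : Type*} [NormedAddCommGroup H] [InnerProductSpace ℝ H]

theorem ofReal_inner_sq_le_liminf {ι : Type*} {l : Filter ι} [l.NeBot] {y : ι → H} {θ : H}
    (hy : Tendsto y l (𝓝 0)) (hy0 : ∀ i, y i ≠ 0)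
    (hθ : Tendsto (fun i => ‖y i‖⁻¹ • y i) l (𝓝 θ)) (x : H) :
    ENNReal.ofReal (2 / Real.pi ^ 2 * ⟪x, θ⟫ ^ 2) ≤
      liminf (fun i => ENNReal.ofReal ((1 - Real.cos ⟪x, y i⟫) / ‖y i‖ ^ 2)) l := by
  have hlim : Tendsto (fun i => ENNReal.ofReal (2 / Real.pi ^ 2 * ⟪x, ‖y i‖⁻¹ • y i⟫ ^ 2)) l
      (𝓝 (ENNReal.ofReal (2 / Real.pi ^ 2 * ⟪x, θ⟫ ^ 2))) :=
    ENNReal.tendsto_ofReal (((tendsto_const_nhds.inner hθ).pow 2).const_mul _)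
  have hsmall : Tendsto (fun i => ⟪x, y i⟫) l (𝓝 0) := by
    simpa using tendsto_const_nhds.inner (𝕜 := ℝ) (x := x) hy
  rw [← hlim.liminf_eq]
  refine liminf_le_liminf ?_
  filter_upwards [hsmall.eventually (Metric.closedBall_mem_nhds 0 Real.pi_pos)] with i hi
  have hcos := Real.cos_le_one_sub_mul_cos_sq (mem_closedBall_zero_iff.1 hi)
  have hpos : 0 < ‖y i‖ := norm_pos_iff.2 (hy0 i)
  refine ENNReal.ofReal_le_ofReal ?_
  rw [real_inner_smul_right, le_div_iff₀ (by positivity)]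
  calc 2 / Real.pi ^ 2 * (‖y i‖⁻¹ * ⟪x, y i⟫) ^ 2 * ‖y i‖ ^ 2
    _ = 2 / Real.pi ^ 2 * ⟪x, y i⟫ ^ 2 := by field_simp
    _ ≤ 1 - Real.cos ⟪x, y i⟫ := by linarith

variable [MeasurableSpace H]

/-- The subspace of the directions in which `μ` has a finite second moment. -/
def secondMomentSubspace (μ : Measure H) : Submodule ℝ H where
  carrier := {x | MemLp (fun X => ⟪x, X⟫) 2 μ}
  zero_mem' := by simp
  add_mem' := fun {x y} hx hy => by
    simp only [Set.mem_ofPred_eq, inner_add_left] at *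
    exact hx.add hy
  smul_mem' := fun c x hx => by
    simp only [Set.mem_ofPred_eq, real_inner_smul_left] at *
    exact hx.const_mul c

theorem memLp_two_iff_lintegral_enorm_sq_lt_top {Ω E : Type*} [MeasurableSpace Ω]
    {P : Measure Ω} [NormedAddCommGroup E] {f : Ω → E} (hf : AEStronglyMeasurable f P) :
    MemLp f 2 P ↔ ∫⁻ ω, ‖f ω‖ₑ ^ 2 ∂P < ∞ := by
  have hsq : AEStronglyMeasurable (fun ω => ‖f ω‖ ^ 2) P := hf.norm.pow 2
  rw [memLp_two_iff_integrable_sq_norm hf, Integrable, and_iff_right hsq, HasFiniteIntegral]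
  simp_rw [enorm_pow, enorm_norm]

theorem memLp_two_of_add_prod {Ω Ω' : Type*} [MeasurableSpace Ω] [MeasurableSpace Ω']
    {P : Measure Ω} [IsFiniteMeasure P] {P' : Measure Ω'} [IsProbabilityMeasure P']
    {f : Ω → ℝ} {g : Ω' → ℝ} (hf : AEStronglyMeasurable f P)
    (h : MemLp (fun q : Ω × Ω' => f q.1 + g q.2) 2 (P.prod P')) : MemLp f 2 P := by
  obtain ⟨y, hy⟩ := h.integrable_sq.prod_left_ae.exists
  have hadd : MemLp (fun x => f x + g y) 2 P :=
    (memLp_two_iff_integrable_sq (hf.add aestronglyMeasurable_const)).2 hy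
  exact (hadd.sub (memLp_const (g y))).congr_norm hf (.of_forall fun x => by simp)

variable [BorelSpace H] [SecondCountableTopology H]

theorem integral_one_sub_cos_inner_sub (μ : Measure H) [IsProbabilityMeasure μ] (y : H) :
    ∫ q : H × H, (1 - Real.cos ⟪q.1 - q.2, y⟫) ∂(μ.prod μ) = 1 - ‖charFun μ y‖ ^ 2 := by
  have hnorm_sq : ((‖charFun μ y‖ ^ 2 : ℝ) : ℂ) = ∫ q : H × H,
      Complex.exp ((⟪q.1 - q.2, y⟫ : ℝ) * Complex.I) ∂(μ.prod μ) := by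
    rw [← Complex.normSq_eq_norm_sq, ← Complex.mul_conj, ← charFun_neg, charFun_apply,
      charFun_apply, ← integral_prod_mul]
    congr with q
    rw [← Complex.exp_add, inner_sub_left, inner_neg_right]
    push_cast
    ring_nf
  have hint : Integrable (fun q : H × H =>
      Complex.exp ((⟪q.1 - q.2, y⟫ : ℝ) * Complex.I)) (μ.prod μ) :=
    .of_bound (by fun_prop) 1 (.of_forall fun X => (Complex.norm_exp_ofReal_mul_I _).le)
  have hcos : ∫ q : H × H, Real.cos ⟪q.1 - q.2, y⟫ ∂(μ.prod μ) = ‖charFun μ y‖ ^ 2 := by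
    simp_rw [← Complex.exp_ofReal_mul_I_re]
    exact (integral_re hint).trans (by rw [← hnorm_sq]; exact Complex.ofReal_re _)
  rw [integral_sub (integrable_const _) (.of_bound (by fun_prop) 1
    (.of_forall fun X => Real.abs_cos_le_one _)), hcos]
  simp

theorem lintegral_one_sub_cos_inner_sub_div_le {μ : Measure H} [IsProbabilityMeasure μ] {y : H}
    (hy : y ≠ 0) {K : ℝ} (hK : 1 - ‖charFun μ y‖ ≤ K * ‖y‖ ^ 2) :
    ∫⁻ q : H × H, ENNReal.ofReal ((1 - Real.cos ⟪q.1 - q.2, y⟫) / ‖y‖ ^ 2) ∂(μ.prod μ) ≤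
      ENNReal.ofReal (2 * K) := by
  have h0 (q : H × H) : 0 ≤ (1 - Real.cos ⟪q.1 - q.2, y⟫) / ‖y‖ ^ 2 :=
    div_nonneg (sub_nonneg.2 (Real.cos_le_one _)) (by positivity)
  have hint : Integrable (fun q : H × H => (1 - Real.cos ⟪q.1 - q.2, y⟫) / ‖y‖ ^ 2)
      (μ.prod μ) := by
    refine .of_bound (by fun_prop) (2 / ‖y‖ ^ 2) (.of_forall fun q => ?_)
    rw [Real.norm_of_nonneg (h0 q)]
    gcongr
    linarith [Real.neg_one_le_cos ⟪q.1 - q.2, y⟫]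
  rw [← ofReal_integral_eq_lintegral_ofReal hint (.of_forall h0), integral_div,
    integral_one_sub_cos_inner_sub]
  refine ENNReal.ofReal_le_ofReal ?_
  rw [div_le_iff₀ (by positivity)]
  nlinarith [norm_charFun_le_one (μ := μ) y, norm_nonneg (charFun μ y)]

theorem mem_secondMomentSubspace_of_tendsto {μ : Measure H} [IsProbabilityMeasure μ] {K : ℝ}
    {y : ℕ → H} {θ : H} (hy : Tendsto y atTop (𝓝 0)) (hy0 : ∀ j, y j ≠ 0)
    (hθ : Tendsto (fun j => ‖y j‖⁻¹ • y j) atTop (𝓝 θ))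
    (hK : ∀ j, 1 - ‖charFun μ (y j)‖ ≤ K * ‖y j‖ ^ 2) : θ ∈ secondMomentSubspace μ := by
  have hfatou : ∫⁻ q : H × H, ENNReal.ofReal (2 / Real.pi ^ 2 * ⟪q.1 - q.2, θ⟫ ^ 2) ∂(μ.prod μ) ≤
      ENNReal.ofReal (2 * K) :=
    calc _ ≤ ∫⁻ q : H × H, liminf (fun j => ENNReal.ofReal
            ((1 - Real.cos ⟪q.1 - q.2, y j⟫) / ‖y j‖ ^ 2)) atTop ∂(μ.prod μ) :=
          lintegral_mono fun q => ofReal_inner_sq_le_liminf hy hy0 hθ _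
      _ ≤ liminf (fun j => ∫⁻ q : H × H, ENNReal.ofReal
            ((1 - Real.cos ⟪q.1 - q.2, y j⟫) / ‖y j‖ ^ 2) ∂(μ.prod μ)) atTop :=
          lintegral_liminf_le fun j => by fun_prop
      _ ≤ ENNReal.ofReal (2 * K) := liminf_le_of_frequently_le'
          (.of_forall fun j => lintegral_one_sub_cos_inner_sub_div_le (hy0 j) (hK j))
  refine memLp_two_of_add_prod (P' := μ) (g := fun X => -⟪θ, X⟫) (by fun_prop)
    ((memLp_two_iff_lintegral_enorm_sq_lt_top (by fun_prop)).2 ?_)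
  have hsq (q : H × H) : ENNReal.ofReal (2 / Real.pi ^ 2 * ⟪q.1 - q.2, θ⟫ ^ 2) =
      ENNReal.ofReal (2 / Real.pi ^ 2) * ‖⟪θ, q.1⟫ + -⟪θ, q.2⟫‖ₑ ^ 2 := by
    rw [ENNReal.ofReal_mul (by positivity), ← sub_eq_add_neg, ← inner_sub_right,
      real_inner_comm, ← enorm_pow, Real.enorm_of_nonneg (sq_nonneg _)]
  simp_rw [hsq] at hfatou
  rw [lintegral_const_mul _ (by fun_prop)] at hfatou
  refine lt_top_iff_ne_top.2 fun htop => ?_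
  rw [htop, ENNReal.mul_top (ENNReal.ofReal_pos.2 (by positivity)).ne', top_le_iff] at hfatou
  exact ENNReal.ofReal_ne_top hfatou

end SecondMoment

theorem QuadraticAlongSequence.exists_mem_secondMomentSubspace [IsProbabilityMeasure μ]
    {F : Subsp n} (h : QuadraticAlongSequence μ F) :
    ∃ θ ∈ F, θ ≠ 0 ∧ θ ∈ secondMomentSubspace μ := by
  obtain ⟨K, hK⟩ := h
  obtain ⟨y, hy, hyK⟩ :=
    exists_seq_forall_of_frequently (hK.and_eventually eventually_mem_nhdsWithin)
  have hcompact : IsCompact ((F : Set (Euc n)) ∩ Metric.sphere 0 1) :=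
    (isCompact_sphere 0 1).inter_left F.closed_of_finiteDimensional
  obtain ⟨θ, hθ, k, hk, hlim⟩ := hcompact.tendsto_subseq (x := fun j => ‖y j‖⁻¹ • y j) fun j =>
    ⟨F.smul_mem _ (hyK j).2.1, by simp [norm_smul, show y j ≠ 0 from (hyK j).2.2]⟩
  exact ⟨θ, hθ.1, by rintro rfl; simpa using hθ.2, mem_secondMomentSubspace_of_tendsto
    ((hy.mono_right nhdsWithin_le_nhds).comp hk.tendsto_atTop) (fun j => (hyK (k j)).2.2) hlim
    fun j => (hyK (k j)).1⟩

theorem aeInvariant_of_forall_ae {F : Subsp n}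
    (h : ∀ x ∈ F, ∀ᵐ E : Subsp n ∂ξ, E.starProjection x ∈ F) : AEInvariant ξ F := by
  obtain ⟨s, hs⟩ := (IsNoetherian.noetherian F : F.FG)
  filter_upwards [(Finset.eventually_all s).2 fun v hv => h v (hs ▸ Submodule.subset_span hv)]
    with E hE
  have hle : Submodule.span ℝ (s : Set (Euc n)) ≤
      F.comap (E.starProjection : Euc n →ₗ[ℝ] Euc n) := Submodule.span_le.2 hE
  exact fun x hx => hle (hs ▸ hx)

theorem IsMixture.aeInvariant_secondMomentSubspace [IsProbabilityMeasure μ]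
    (h : IsMixture μ ξ) : AEInvariant ξ (secondMomentSubspace μ) := by
  refine aeInvariant_of_forall_ae fun x hx => ?_
  have hm : Measurable fun X : Euc n => ‖⟪x, X⟫‖ₑ ^ 2 := by fun_prop
  have hfinite : ∫⁻ E, ∫⁻ X, ‖⟪x, X⟫‖ₑ ^ 2 ∂(marginalProd μ E) ∂ξ ≠ ∞ := by
    rw [← Measure.lintegral_bind (measurable_marginalProd μ).aemeasurable hm.aemeasurable, ← h]
    exact ((memLp_two_iff_lintegral_enorm_sq_lt_top (by fun_prop)).1 hx).ne
  filter_upwards [ae_lt_top ((Measure.measurable_lintegral hm).comp (measurable_marginalProd μ))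
    hfinite] with E hE
  rw [Function.comp_apply, marginalProd_eq_map, lintegral_map hm (by fun_prop)] at hE
  refine memLp_two_of_add_prod (P' := μ) (g := fun X => ⟪Eᗮ.starProjection x, X⟫) (by fun_prop)
    ((memLp_two_iff_lintegral_enorm_sq_lt_top (by fun_prop)).2 ?_)
  simpa only [inner_add_right, Submodule.inner_starProjection_left_eq_right] using hE

theorem IsMixture.depSubspace_le_secondMomentSubspace [IsProbabilityMeasure μ]
    [IsProbabilityMeasure ξ] (h : IsMixture μ ξ)
    (hq : ∀ F ≤ depSubspace ξ, AEInvariant ξ F → F ≠ ⊥ → QuadraticAlongSequence μ F) :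
    depSubspace ξ ≤ secondMomentSubspace μ := by
  set V := secondMomentSubspace μ ⊓ depSubspace ξ
  have hinv : AEInvariant ξ (Vᗮ ⊓ depSubspace ξ) :=
    (h.aeInvariant_secondMomentSubspace.inf (aeInvariant_depSubspace ξ)).orthogonal.inf
      (aeInvariant_depSubspace ξ)
  have hbot : Vᗮ ⊓ depSubspace ξ = ⊥ := by
    by_contra hne
    obtain ⟨θ, hθ, hθ0, hθm⟩ := (hq _ inf_le_right hinv hne).exists_mem_secondMomentSubspace
    exact hθ0 (inner_self_eq_zero.1 ((Submodule.mem_orthogonal _ _).1 hθ.1 θ ⟨hθm, hθ.2⟩))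
  have hsup : V ⊔ Vᗮ ⊓ depSubspace ξ = depSubspace ξ :=
    Submodule.sup_orthogonal_inf_of_hasOrthogonalProjection inf_le_right
  rw [hbot, sup_bot_eq] at hsup
  exact hsup ▸ inf_le_left

theorem memLp_starProjection_of_le_secondMomentSubspace {F : Subsp n}
    (h : F ≤ secondMomentSubspace μ) : MemLp F.starProjection 2 μ := by
  refine MemLp.of_eval_piLp fun i => ?_
  have hcoord : (fun X => (F.starProjection X) i) =
      fun X => ⟪F.starProjection (EuclideanSpace.basisFun (Fin n) ℝ i), X⟫ := by
    funext X
    rw [F.inner_starProjection_left_eq_right, EuclideanSpace.basisFun_inner]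
  rw [hcoord]
  exact h (F.starProjection_apply_mem _)

/-! ### The covariance of a mixture -/

theorem IsMixture.map_starProjection_depSubspace [IsProbabilityMeasure μ]
    [IsProbabilityMeasure ξ] (h : IsMixture μ ξ) :
    IsMixture (μ.map (depSubspace ξ).starProjection) ξ := by
  have : IsProbabilityMeasure (μ.map (depSubspace ξ).starProjection) :=
    Measure.isProbabilityMeasure_map (by fun_prop)
  refine isMixture_iff_lintegral.2 fun f hf => ?_
  rw [lintegral_map hf (by fun_prop), isMixture_iff_lintegral.1 h
    (fun X => f ((depSubspace ξ).starProjection X)) (by fun_prop)]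
  refine lintegral_congr_ae ?_
  filter_upwards [aeInvariant_depSubspace ξ] with E hE
  rw [Measure.map_prod_map _ _ (by fun_prop) (by fun_prop), lintegral_map (by fun_prop)
    (by fun_prop)]
  simp_rw [map_add, starProjection_comm_of_mapsTo hE,
    starProjection_comm_of_mapsTo fun _ => orthogonal_starProjection_mem hE, Prod.map_fst,
    Prod.map_snd]

theorem inner_covOp (μ : Measure (Euc n)) (x y : Euc n) :
    ⟪covOp μ x, y⟫ = covarianceBilin μ x y :=
  InnerProductSpace.continuousLinearMapOfBilin_apply _ x y

theorem inner_covOp_comm (μ : Measure (Euc n)) (x y : Euc n) :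
    ⟪covOp μ x, y⟫ = ⟪x, covOp μ y⟫ := by
  rw [inner_covOp, real_inner_comm, inner_covOp, covarianceBilin_comm]

theorem lintegral_sq_add_of_centered {Ω : Type*} [MeasurableSpace Ω] {P : Measure Ω}
    [IsProbabilityMeasure P] {f g : Ω → ℝ} (hf : MemLp f 2 P) (hg : MemLp g 2 P)
    (hf0 : ∫ x, f x ∂P = 0) :
    ∫⁻ q : Ω × Ω, ENNReal.ofReal ((f q.1 + g q.2) ^ 2) ∂(P.prod P) =
      ENNReal.ofReal (∫ x, f x ^ 2 ∂P + ∫ x, g x ^ 2 ∂P) := by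
  have hsq : Integrable (fun q : Ω × Ω => f q.1 ^ 2 + g q.2 ^ 2) (P.prod P) :=
    (hf.integrable_sq.comp_fst P).fun_add (hg.integrable_sq.comp_snd P)
  have hcross : Integrable (fun q : Ω × Ω => 2 * (f q.1 * g q.2)) (P.prod P) :=
    ((hf.integrable one_le_two).mul_prod (hg.integrable one_le_two)).const_mul 2
  have hexpand (q : Ω × Ω) :
      (f q.1 + g q.2) ^ 2 = f q.1 ^ 2 + g q.2 ^ 2 + 2 * (f q.1 * g q.2) := by ring
  rw [← ofReal_integral_eq_lintegral_ofReal (by simpa only [hexpand] using hsq.fun_add hcross)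
    (.of_forall fun q => sq_nonneg _)]
  simp_rw [hexpand]
  rw [integral_add hsq hcross, integral_add (hf.integrable_sq.comp_fst P)
    (hg.integrable_sq.comp_snd P), integral_const_mul, integral_prod_mul, hf0,
    integral_fun_fst (fun x => f x ^ 2), integral_fun_snd (fun x => g x ^ 2)]
  simp

theorem IsMixture.ofReal_covarianceBilin_self [IsProbabilityMeasure μ] (h : IsMixture μ ξ)
    (hμ : MemLp id 2 μ) (x : Euc n) :
    ENNReal.ofReal (covarianceBilin μ x x) = ∫⁻ E : Subsp n, ENNReal.ofReal
      (covarianceBilin μ (E.starProjection x) (E.starProjection x) +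
        covarianceBilin μ (Eᗮ.starProjection x) (Eᗮ.starProjection x)) ∂ξ := by
  let m := ∫ X, X ∂μ
  have hL (y : Euc n) : MemLp (fun X => ⟪y, X - m⟫) 2 μ :=
    (hμ.sub (memLp_const m)).const_inner y
  have hcentered (y : Euc n) : ∫ X, ⟪y, X - m⟫ ∂μ = 0 := by
    have hid : Integrable (fun X => X) μ := hμ.integrable one_le_two
    have hsub : Integrable (fun X => X - m) μ := hid.sub (integrable_const m)
    rw [integral_inner hsub, integral_sub hid (integrable_const m)]
    simp [m]
  have hcov (y : Euc n) : covarianceBilin μ y y = ∫ X, ⟪y, X - m⟫ ^ 2 ∂μ := by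
    simp_rw [covarianceBilin_apply hμ, sq, id, m]
  rw [hcov, ofReal_integral_eq_lintegral_ofReal (hL x).integrable_sq
    (.of_forall fun q => sq_nonneg _), isMixture_iff_lintegral.1 h _ (by fun_prop)]
  refine lintegral_congr fun E => ?_
  rw [hcov, hcov, ← lintegral_sq_add_of_centered (hL _) (hL _) (hcentered _)]
  refine lintegral_congr fun q => ?_
  have hm : E.starProjection m + Eᗮ.starProjection m = m :=
    E.starProjection_add_starProjection_orthogonal m
  rw [E.inner_starProjection_left_eq_right, Eᗮ.inner_starProjection_left_eq_right,
    ← inner_add_right, map_sub, map_sub, sub_add_sub_comm, hm]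

theorem integrable_apply_starProjection_orthogonal [IsFiniteMeasure ξ]
    (B : Euc n →L[ℝ] Euc n →L[ℝ] ℝ) (x y : Euc n) :
    Integrable (fun E : Subsp n => B (E.starProjection x) (Eᗮ.starProjection y)) ξ := by
  have hcont : Continuous fun E : Subsp n => B (E.starProjection x) (Eᗮ.starProjection y) :=
    (B.continuous.comp (continuous_starProjection_subsp.clm_apply continuous_const)).clm_apply
      (continuous_starProjection_orthogonal_subsp.clm_apply continuous_const)
  refine .of_bound hcont.measurable.aestronglyMeasurable (‖B‖ * ‖x‖ * ‖y‖)
    (.of_forall fun E => (B.le_opNorm₂ _ _).trans ?_)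
  gcongr <;> exact Submodule.norm_starProjection_apply_le _ _

theorem covarianceBilin_self_eq_starProjection_add (μ : Measure (Euc n)) (E : Subsp n)
    (x : Euc n) : covarianceBilin μ x x =
      covarianceBilin μ (E.starProjection x) (E.starProjection x) +
        covarianceBilin μ (Eᗮ.starProjection x) (Eᗮ.starProjection x) +
        2 * covarianceBilin μ (E.starProjection x) (Eᗮ.starProjection x) := by
  nth_rewrite 1 2 [← E.starProjection_add_starProjection_orthogonal x]
  simp only [map_add, add_apply]
  rw [covarianceBilin_comm (Eᗮ.starProjection x) (E.starProjection x)]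
  ring

theorem IsMixture.integral_covarianceBilin_starProjection_orthogonal [IsProbabilityMeasure μ]
    [IsProbabilityMeasure ξ] (h : IsMixture μ ξ) (hμ : MemLp id 2 μ) (x : Euc n) :
    ∫ E : Subsp n, covarianceBilin μ (E.starProjection x) (Eᗮ.starProjection x) ∂ξ = 0 := by
  have hdiag (E : Subsp n) : covarianceBilin μ (E.starProjection x) (E.starProjection x) +
      covarianceBilin μ (Eᗮ.starProjection x) (Eᗮ.starProjection x) = covarianceBilin μ x x -
        2 * covarianceBilin μ (E.starProjection x) (Eᗮ.starProjection x) :=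
    eq_sub_of_add_eq (covarianceBilin_self_eq_starProjection_add μ E x).symm
  have hnonneg (E : Subsp n) : 0 ≤ covarianceBilin μ x x -
      2 * covarianceBilin μ (E.starProjection x) (Eᗮ.starProjection x) :=
    hdiag E ▸ add_nonneg (covarianceBilin_self_nonneg _) (covarianceBilin_self_nonneg _)
  have hint := (integrable_apply_starProjection_orthogonal (ξ := ξ)
    (covarianceBilin μ) x x).const_mul 2
  have hcov := h.ofReal_covarianceBilin_self hμ x
  have hsub : Integrable (fun E : Subsp n => covarianceBilin μ x x -
      2 * covarianceBilin μ (E.starProjection x) (Eᗮ.starProjection x)) ξ :=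
    (integrable_const _).sub hint
  simp_rw [hdiag] at hcov
  rw [← ofReal_integral_eq_lintegral_ofReal hsub (.of_forall hnonneg),
    ENNReal.ofReal_eq_ofReal_iff (covarianceBilin_self_nonneg _) (integral_nonneg hnonneg),
    integral_sub (integrable_const _) hint, integral_const_mul, integral_const, probReal_univ,
    one_smul] at hcov
  linarith

theorem sum_inner_starProjection_orthogonal_eq_sum_norm_sq {H ι : Type*} [NormedAddCommGroup H]
    [InnerProductSpace ℝ H] [Fintype ι] (b : OrthonormalBasis ι ℝ H) {A : H →ₗ[ℝ] H}
    (hA : A.IsSymmetric) (E : Submodule ℝ H) [E.HasOrthogonalProjection] :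
    ∑ i, ⟪A (E.starProjection (b i)), Eᗮ.starProjection (A (b i))⟫ =
      ∑ i, ‖Eᗮ.starProjection (A (E.starProjection (b i)))‖ ^ 2 := by
  let P : H →ₗ[ℝ] H := E.starProjection
  let Q : H →ₗ[ℝ] H := Eᗮ.starProjection
  have hPP : P * P = P :=
    LinearMap.ext fun x => Submodule.starProjection_eq_self_iff.2 (E.starProjection_apply_mem x)
  have hleft (i : ι) : ⟪A (E.starProjection (b i)), Eᗮ.starProjection (A (b i))⟫ =
      ⟪b i, (P * (A * Q * A)) (b i)⟫ := by
    rw [hA, E.inner_starProjection_left_eq_right]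
    rfl
  have hright (i : ι) : ‖Eᗮ.starProjection (A (E.starProjection (b i)))‖ ^ 2 =
      ⟪b i, (P * (A * Q * A) * P) (b i)⟫ := by
    rw [← real_inner_self_eq_norm_sq, Eᗮ.inner_starProjection_left_eq_right,
      Submodule.starProjection_eq_self_iff.2 (Eᗮ.starProjection_apply_mem _), hA,
      E.inner_starProjection_left_eq_right]
    rfl
  simp_rw [hleft, hright, ← LinearMap.trace_eq_sum_inner _ b]
  rw [LinearMap.trace_mul_comm ℝ _ P, ← mul_assoc P P, hPP]

-- For an eigenbasis `(bᵢ, λᵢ)` of `A = Cov μ`, the sum `∑ λᵢ Cov(P_E bᵢ, P_{Eᗮ} bᵢ)` has zero mean,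
-- and it is the trace of `P_E A P_{Eᗮ} A`, that is, the squared norm of `P_{Eᗮ} A P_E`.
theorem IsMixture.ae_starProjection_covOp_orthogonal_eq_zero [IsProbabilityMeasure μ]
    [IsProbabilityMeasure ξ] (h : IsMixture μ ξ) (hμ : MemLp id 2 μ) :
    ∀ᵐ E : Subsp n ∂ξ, E.starProjection ∘L covOp μ ∘L Eᗮ.starProjection = 0 := by
  have hsymm : (covOp μ : Euc n →ₗ[ℝ] Euc n).IsSymmetric := inner_covOp_comm μ
  let b := hsymm.eigenvectorBasis finrank_euclideanSpace_fin
  let l := hsymm.eigenvalues finrank_euclideanSpace_fin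
  have hterm (E : Subsp n) : ∑ i, l i * covarianceBilin μ (E.starProjection (b i))
      (Eᗮ.starProjection (b i)) =
      ∑ i, ‖Eᗮ.starProjection (covOp μ (E.starProjection (b i)))‖ ^ 2 := by
    refine .trans (Finset.sum_congr rfl fun i _ => ?_)
      (sum_inner_starProjection_orthogonal_eq_sum_norm_sq b hsymm E)
    rw [hsymm.apply_eigenvectorBasis, map_smul, real_inner_smul_right]
    exact congrArg _ (inner_covOp μ _ _).symm
  have hint (i : Fin n) := (integrable_apply_starProjection_orthogonal (ξ := ξ)
    (covarianceBilin μ) (b i) (b i)).const_mul (l i)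
  have hzero : ∫ E : Subsp n, ∑ i, l i * covarianceBilin μ (E.starProjection (b i))
      (Eᗮ.starProjection (b i)) ∂ξ = 0 := by
    rw [integral_finsetSum _ fun i _ => hint i]
    simp_rw [integral_const_mul, h.integral_covarianceBilin_starProjection_orthogonal hμ,
      mul_zero, Finset.sum_const_zero]
  rw [integral_eq_zero_iff_of_nonneg (fun E => (hterm E).symm ▸ by positivity)
    (integrable_finsetSum _ fun i _ => hint i)] at hzero
  filter_upwards [hzero] with E hE
  rw [hterm, Pi.zero_apply, Finset.sum_eq_zero_iff_of_nonneg fun i _ => sq_nonneg _] at hE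
  have hQAP : Eᗮ.starProjection ∘L covOp μ ∘L E.starProjection = 0 :=
    ContinuousLinearMap.coe_injective <| b.toBasis.ext fun i => by
      simpa using hE i (Finset.mem_univ i)
  refine ContinuousLinearMap.ext fun x => ext_inner_right ℝ fun y => ?_
  have hy : Eᗮ.starProjection (covOp μ (E.starProjection y)) = 0 := congr($hQAP y)
  simp only [ContinuousLinearMap.comp_apply, zero_apply, inner_zero_left]
  rw [E.inner_starProjection_left_eq_right, inner_covOp_comm,
    Eᗮ.inner_starProjection_left_eq_right, hy, inner_zero_right]

theorem covarianceBilin_self_eq_of_covOp {E : Subsp n}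
    (h : E.starProjection ∘L covOp μ ∘L Eᗮ.starProjection = 0) (x : Euc n) :
    covarianceBilin μ x x = covarianceBilin μ (E.starProjection x) (E.starProjection x) +
      covarianceBilin μ (Eᗮ.starProjection x) (Eᗮ.starProjection x) := by
  have hx : E.starProjection (covOp μ (Eᗮ.starProjection x)) = 0 := congr($h x)
  have hcross : covarianceBilin μ (E.starProjection x) (Eᗮ.starProjection x) = 0 := by
    rw [← inner_covOp, inner_covOp_comm, E.inner_starProjection_left_eq_right, hx,
      inner_zero_right]
  rw [covarianceBilin_self_eq_starProjection_add μ E x, hcross, mul_zero, add_zero]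

/-! ### Gaussianity on the dependent subspace -/

theorem isLittleO_of_iteratedFDeriv_eq_zero.{u} {E F : Type u} [NormedAddCommGroup E]
    [NormedSpace ℝ E] [NormedAddCommGroup F] [NormedSpace ℝ F] {k : ℕ} {f : E → F} {x₀ : E}
    (hf : ContDiff ℝ k f) (h0 : ∀ i ≤ k, iteratedFDeriv ℝ i f x₀ = 0) :
    f =o[𝓝 x₀] fun x => ‖x - x₀‖ ^ k := by
  have hfx : f x₀ = 0 := by simpa using congr($(h0 0 k.zero_le) 0)
  induction k generalizing F with
  | zero => simpa [← hfx] using hf.continuous.tendsto x₀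
  | succ k ih =>
    have hfderiv (i : ℕ) (hi : i ≤ k) : iteratedFDeriv ℝ i (fderiv ℝ f) x₀ = 0 := by
      rw [← norm_eq_zero, norm_iteratedFDeriv_fderiv, h0 _ (by lia), norm_zero]
    have hderiv := ih (hf.fderiv_right le_rfl) hfderiv
      (by simpa using congr($(hfderiv 0 k.zero_le) 0))
    rw [← nhdsWithin_univ] at hderiv ⊢
    simpa [hfx] using convex_univ.isLittleO_pow_succ (Set.mem_univ x₀)
      (fun x _ => (hf.differentiable (by simp) x).hasFDerivAt.hasFDerivWithinAt) hderiv

theorem exists_isGaussian_covarianceBilin_eq (μ : Measure (Euc n)) :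
    ∃ ν : Measure (Euc n), IsGaussian ν ∧ ν[id] = μ[id] ∧
      covarianceBilin ν = covarianceBilin μ := by
  let b := (EuclideanSpace.basisFun (Fin n) ℝ).toBasis
  let S := LinearMap.BilinForm.toMatrix b (covarianceBilin μ).toBilinForm
  have hform (x y : Fin n → ℝ) :
      x ⬝ᵥ S.mulVec y = covarianceBilin μ (WithLp.toLp 2 x) (WithLp.toLp 2 y) :=
    LinearMap.BilinForm.dotProduct_toMatrix_mulVec b (covarianceBilin μ).toBilinForm x y
  have hS : S.PosSemidef := by
    refine .of_dotProduct_mulVec_nonneg ?_ fun x => ?_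
    · ext i j
      exact covarianceBilin_comm _ _
    · rw [star_trivial, hform]
      exact covarianceBilin_self_nonneg _
  refine ⟨multivariateGaussian μ[id] S, inferInstance, integral_id_multivariateGaussian', ?_⟩
  ext x y
  rw [covarianceBilin_multivariateGaussian hS, hform]

theorem integral_inner_eq_inner_mean [IsFiniteMeasure μ] (hμ : MemLp id 2 μ) (w : Euc n) :
    ∫ y, ⟪y, w⟫ ∂μ = ⟪μ[id], w⟫ := by
  simp_rw [real_inner_comm w]
  exact integral_inner (hμ.integrable one_le_two) w

theorem integral_inner_mul_inner [IsProbabilityMeasure μ] (hμ : MemLp id 2 μ) (u v : Euc n) :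
    ∫ y, ⟪y, u⟫ * ⟪y, v⟫ ∂μ = covarianceBilin μ u v + ⟪μ[id], u⟫ * ⟪μ[id], v⟫ := by
  rw [covarianceBilin_apply_eq_cov hμ,
    covariance_eq_sub (X := fun y => ⟪u, y⟫) (Y := fun y => ⟪v, y⟫)
      (hμ.const_inner u) (hμ.const_inner v),
    ← integral_inner_eq_inner_mean hμ, ← integral_inner_eq_inner_mean hμ]
  simp [real_inner_comm]

theorem charFun_sub_charFun_isLittleO {ν : Measure (Euc n)} [IsProbabilityMeasure μ]
    [IsProbabilityMeasure ν] (hμ : MemLp id 2 μ) (hν : MemLp id 2 ν) (hmean : μ[id] = ν[id])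
    (hcov : covarianceBilin μ = covarianceBilin ν) :
    (fun x => charFun μ x - charFun ν x) =o[𝓝 0] fun x => ‖x‖ ^ 2 := by
  have hzero (k : ℕ) (hk : k ≤ 2) :
      iteratedFDeriv ℝ k (charFun μ - charFun ν) 0 = 0 := by
    have hμk : MemLp id k μ := hμ.mono_exponent (by exact_mod_cast hk)
    have hνk : MemLp id k ν := hν.mono_exponent (by exact_mod_cast hk)
    rw [iteratedFDeriv_sub_apply (contDiff_charFun hμk).contDiffAt
      (contDiff_charFun hνk).contDiffAt, sub_eq_zero]
    ext x
    rw [iteratedFDeriv_charFun hμk, iteratedFDeriv_charFun hνk]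
    congr 1
    simp only [inner_zero_right, Complex.ofReal_zero, zero_mul, Complex.exp_zero, mul_one,
      integral_complex_ofReal]
    congr 1
    interval_cases k
    · simp
    · simp_rw [Fin.prod_univ_one, integral_inner_eq_inner_mean hμ,
        integral_inner_eq_inner_mean hν, hmean]
    · simp_rw [Fin.prod_univ_two, integral_inner_mul_inner hμ, integral_inner_mul_inner hν, hmean,
        hcov]
  simpa using isLittleO_of_iteratedFDeriv_eq_zero (k := 2)
    ((contDiff_charFun hμ).sub (contDiff_charFun hν)) hzero

theorem norm_mul_sub_mul_le {R : Type*} [NonUnitalSeminormedRing R] {a b c d : R} (hb : ‖b‖ ≤ 1)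
    (hc : ‖c‖ ≤ 1) : ‖a * b - c * d‖ ≤ ‖a - c‖ + ‖b - d‖ :=
  calc ‖a * b - c * d‖ = ‖(a - c) * b + c * (b - d)‖ := by noncomm_ring
    _ ≤ ‖a - c‖ * ‖b‖ + ‖c‖ * ‖b - d‖ :=
      (norm_add_le _ _).trans (add_le_add (norm_mul_le _ _) (norm_mul_le _ _))
    _ ≤ ‖a - c‖ * 1 + 1 * ‖b - d‖ := by gcongr
    _ = ‖a - c‖ + ‖b - d‖ := by rw [mul_one, one_mul]

theorem IsMixture.enorm_charFun_sub_le_splitOp [IsProbabilityMeasure μ] [IsProbabilityMeasure ξ]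
    (h : IsMixture μ ξ) {g : Euc n → ℂ} (hg : ∀ x, ‖g x‖ ≤ 1) {x : Euc n}
    (hfac : ∀ᵐ E : Subsp n ∂ξ, g x = g (E.starProjection x) * g (Eᗮ.starProjection x)) :
    ‖charFun μ x - g x‖ₑ ≤ splitOp ξ (fun y => ‖charFun μ y - g y‖ₑ) x := by
  have hdiff : charFun μ x - g x = ∫ E : Subsp n, (charFun μ (E.starProjection x) *
      charFun μ (Eᗮ.starProjection x) - g x) ∂ξ := by
    rw [integral_sub (integrable_charFun_mul_charFun μ ξ x) (integrable_const _),
      ← h.charFun_eq x, integral_const, probReal_univ, one_smul]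
  rw [hdiff]
  refine (enorm_integral_le_lintegral_enorm _).trans (lintegral_mono_ae ?_)
  filter_upwards [hfac] with E hE
  rw [hE, ← ofReal_norm, ← ofReal_norm, ← ofReal_norm,
    ← ENNReal.ofReal_add (norm_nonneg _) (norm_nonneg _)]
  exact ENNReal.ofReal_le_ofReal (norm_mul_sub_mul_le (norm_charFun_le_one _) (hg _))

theorem factorsAlong_charFun_of_isGaussian (hμ : IsGaussian μ) {E : Subsp n}
    (h : E.starProjection ∘L covOp μ ∘L Eᗮ.starProjection = 0) : FactorsAlong (charFun μ) E := by
  intro x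
  simp only [hμ.charFun_eq', covarianceBilin_self_eq_of_covOp h x]
  rw [← Complex.exp_add]
  nth_rewrite 1 [← E.starProjection_add_starProjection_orthogonal x]
  rw [inner_add_left]
  push_cast
  ring_nf

theorem splitOp_const_mul_enorm_sq [IsProbabilityMeasure ξ] (c : ℝ≥0∞) (x : Euc n) :
    splitOp ξ (fun y => c * ‖y‖ₑ ^ 2) x = c * ‖x‖ₑ ^ 2 := by
  have hpyth (E : Subsp n) :
      c * ‖E.starProjection x‖ₑ ^ 2 + c * ‖Eᗮ.starProjection x‖ₑ ^ 2 = c * ‖x‖ₑ ^ 2 := by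
    simp_rw [← mul_add, ← ofReal_norm, ← ENNReal.ofReal_pow (norm_nonneg _)]
    rw [← ENNReal.ofReal_add (by positivity) (by positivity),
      ← E.norm_sq_eq_add_norm_sq_starProjection x]
  simp_rw [splitOp, hpyth, lintegral_const, measure_univ, mul_one]

theorem exists_norm_le_add_pow_four {E F : Type*} [SeminormedAddCommGroup E]
    [SeminormedAddCommGroup F] {f : E → F} {M : ℝ} (hM : ∀ x, ‖f x‖ ≤ M)
    (ho : f =o[𝓝 0] fun x => ‖x‖ ^ 2) {ε : ℝ} (hε : 0 < ε) :
    ∃ C, 0 ≤ C ∧ ∀ x, ‖f x‖ ≤ ε * ‖x‖ ^ 2 + C * ‖x‖ ^ 4 := by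
  obtain ⟨δ, hδ, hball⟩ := Metric.eventually_nhds_iff.1 (ho.def hε)
  have hM0 : 0 ≤ M := (norm_nonneg _).trans (hM 0)
  refine ⟨M / δ ^ 4, by positivity, fun x => ?_⟩
  rcases lt_or_ge ‖x‖ δ with hx | hx
  · have hsmall := hball (dist_zero_right x ▸ hx)
    rw [norm_pow, norm_norm] at hsmall
    exact hsmall.trans (le_add_of_nonneg_right (by positivity))
  · calc ‖f x‖ ≤ M / δ ^ 4 * δ ^ 4 := by rw [div_mul_cancel₀ _ (by positivity)]; exact hM x
      _ ≤ M / δ ^ 4 * ‖x‖ ^ 4 := by gcongr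
      _ ≤ ε * ‖x‖ ^ 2 + M / δ ^ 4 * ‖x‖ ^ 4 := le_add_of_nonneg_left (by positivity)

theorem eq_zero_of_subharmonic_of_isLittleO [IsProbabilityMeasure ξ] {F : Type*}
    [NormedAddCommGroup F] {f : Euc n → F} {M : ℝ} (hM : ∀ x, ‖f x‖ ≤ M)
    (ho : f =o[𝓝 0] fun x => ‖x‖ ^ 2)
    (hsub : ∀ x, ‖f x‖ₑ ≤ splitOp ξ (fun y => ‖f y‖ₑ) x) {x : Euc n} (hx : x ∈ depSubspace ξ) :
    f x = 0 := by
  have hle (ε : ℝ) (hε : 0 < ε) : ‖f x‖ ≤ ε * ‖x‖ ^ 2 := by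
    obtain ⟨C, hC, hCle⟩ := exists_norm_le_add_pow_four hM ho hε
    have hpow (y : Euc n) (c : ℝ) (hc : 0 ≤ c) (k : ℕ) :
        ENNReal.ofReal c * ‖y‖ₑ ^ k = ENNReal.ofReal (c * ‖y‖ ^ k) := by
      rw [ENNReal.ofReal_mul hc, ENNReal.ofReal_pow (norm_nonneg _), ofReal_norm]
    have henorm := le_of_subharmonic
      ((aeInvariant_depSubspace ξ).splitInvariant_inter_closedBall ‖x‖)
      (N := fun y => ENNReal.ofReal ε * ‖y‖ₑ ^ 2) (by fun_prop)
      (fun y _ => (splitOp_const_mul_enorm_sq _ y).le)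
      ((contractedOn_enorm_pow_four ξ).mono Set.inter_subset_left) (by simp)
      (fun y _ => hsub y) (C := ENNReal.ofReal C) ENNReal.ofReal_ne_top
      (fun y _ => by
        rw [hpow y ε hε.le, hpow y C hC, ← ENNReal.ofReal_add (by positivity) (by positivity),
          ← ofReal_norm]
        exact ENNReal.ofReal_le_ofReal (hCle y))
      x ⟨hx, by simp⟩
    rwa [hpow x ε hε.le, ← ofReal_norm, ENNReal.ofReal_le_ofReal_iff (by positivity)] at henorm
  have hlim : Tendsto (fun ε : ℝ => ε * ‖x‖ ^ 2) (𝓝[>] 0) (𝓝 0) :=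
    tendsto_nhdsWithin_of_tendsto_nhds (Continuous.tendsto' (by fun_prop) _ _ (zero_mul _))
  exact norm_le_zero_iff.1 (ge_of_tendsto hlim (eventually_mem_nhdsWithin.mono hle))

theorem IsMixture.exists_isGaussian_charFun_eq [IsProbabilityMeasure μ] [IsProbabilityMeasure ξ]
    (h : IsMixture μ ξ) (hμ : MemLp id 2 μ) :
    ∃ ν : Measure (Euc n), IsGaussian ν ∧ ∀ x ∈ depSubspace ξ, charFun μ x = charFun ν x := by
  obtain ⟨ν, hν, hmean, hcov⟩ := exists_isGaussian_covarianceBilin_eq μ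
  have hcovOp : covOp ν = covOp μ := by rw [covOp, covOp, hcov]
  refine ⟨ν, hν, fun x hx => sub_eq_zero.1 ?_⟩
  refine eq_zero_of_subharmonic_of_isLittleO (ξ := ξ) (f := fun y => charFun μ y - charFun ν y)
    (M := 2) (fun y => ?_)
    (charFun_sub_charFun_isLittleO hμ IsGaussian.memLp_two_id hmean.symm hcov.symm)
    (fun y => h.enorm_charFun_sub_le_splitOp (fun z => norm_charFun_le_one z) ?_) hx
  · calc _ ≤ ‖charFun μ y‖ + ‖charFun ν y‖ := norm_sub_le _ _
      _ ≤ 1 + 1 := add_le_add (norm_charFun_le_one y) (norm_charFun_le_one y)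
      _ = 2 := one_add_one_eq_two
  · filter_upwards [h.ae_starProjection_covOp_orthogonal_eq_zero hμ] with E hE
    exact factorsAlong_charFun_of_isGaussian hν (hcovOp ▸ hE) y

theorem marginal_eq_map_map_starProjection (μ : Measure (Euc n)) (V : Subsp n) :
    marginal μ V = (μ.map V.starProjection).map V.orthogonalProjectionOnto := by
  rw [Measure.map_map (by fun_prop) (by fun_prop), marginal]
  congr 1
  funext x
  exact (V.orthogonalProjectionOnto_mem_subspace_eq_self (V.orthogonalProjectionOnto x)).symm

theorem map_starProjection_eq_map_marginal (μ : Measure (Euc n)) (V : Subsp n) :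
    μ.map V.starProjection = (marginal μ V).map V.subtypeL := by
  rw [marginal, Measure.map_map (by fun_prop) (by fun_prop)]
  rfl

theorem covSplits_iff_ae [IsProbabilityMeasure ξ] {V : Subsp n} :
    CovSplits μ V ξ ↔ ∀ᵐ E : Subsp n ∂ξ,
      E.starProjection ∘L covOp (μ.map V.starProjection) ∘L Eᗮ.starProjection = 0 := by
  let f (E : Subsp n) : ℝ :=
    ‖E.starProjection ∘L covOp (μ.map V.starProjection) ∘L Eᗮ.starProjection‖
  have hint : Integrable f ξ := by
    refine .of_bound (Continuous.measurable ?_).aestronglyMeasurable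
      (1 * (‖covOp (μ.map V.starProjection)‖ * 1)) (.of_forall fun E => ?_)
    · exact (continuous_starProjection_subsp.clm_comp
        (continuous_const.clm_comp continuous_starProjection_orthogonal_subsp)).norm
    · rw [norm_norm]
      refine (ContinuousLinearMap.opNorm_comp_le _ _).trans ?_
      gcongr
      · exact E.starProjection_norm_le
      · refine (ContinuousLinearMap.opNorm_comp_le _ _).trans ?_
        gcongr
        exact Eᗮ.starProjection_norm_le
  rw [CovSplits, integral_eq_zero_iff_of_nonneg (fun E => norm_nonneg _) hint]
  exact eventually_congr (.of_forall fun E => norm_eq_zero)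

theorem IsMixture.isGaussian_and_covSplits [IsProbabilityMeasure μ] [IsProbabilityMeasure ξ]
    (h : IsMixture μ ξ) (hdep : depSubspace ξ ≤ secondMomentSubspace μ) :
    IsGaussian (marginal μ (depSubspace ξ)) ∧ CovSplits μ (depSubspace ξ) ξ := by
  let P := (depSubspace ξ).starProjection
  have : IsProbabilityMeasure (μ.map P) := Measure.isProbabilityMeasure_map (by fun_prop)
  have hmem : MemLp id 2 (μ.map P) := (memLp_map_measure_iff (by fun_prop) (by fun_prop)).2
    (memLp_starProjection_of_le_secondMomentSubspace hdep)
  have hmix : IsMixture (μ.map P) ξ := h.map_starProjection_depSubspace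
  refine ⟨?_, covSplits_iff_ae.2 (hmix.ae_starProjection_covOp_orthogonal_eq_zero hmem)⟩
  obtain ⟨ν, hν, hφ⟩ := hmix.exists_isGaussian_charFun_eq hmem
  have hPdep (y : Euc n) : P y ∈ depSubspace ξ := (depSubspace ξ).starProjection_apply_mem y
  have hμν : μ.map P = ν.map P := by
    refine Measure.ext_of_charFun (funext fun y => ?_)
    rw [charFun_map_starProjection, charFun_map_starProjection, ← hφ _ (hPdep y),
      charFun_map_starProjection, Submodule.starProjection_eq_self_iff.2 (hPdep y)]
  rw [marginal_eq_map_map_starProjection, hμν]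
  infer_instance

theorem ae_charFun_eq_mul_of_isGaussian [IsProbabilityMeasure ξ]
    (hg : IsGaussian (marginal μ (depSubspace ξ))) (hc : CovSplits μ (depSubspace ξ) ξ) :
    ∀ᵐ E : Subsp n ∂ξ, ∀ z ∈ depSubspace ξ,
      charFun μ z = charFun μ (E.starProjection z) * charFun μ (Eᗮ.starProjection z) := by
  have hgauss : IsGaussian (μ.map (depSubspace ξ).starProjection) := by
    rw [map_starProjection_eq_map_marginal]
    infer_instance
  have hφ (z : Euc n) (hz : z ∈ depSubspace ξ) :
      charFun μ z = charFun (μ.map (depSubspace ξ).starProjection) z := by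
    rw [charFun_map_starProjection, Submodule.starProjection_eq_self_iff.2 hz]
  filter_upwards [covSplits_iff_ae.1 hc, aeInvariant_depSubspace ξ] with E hE hdep z hz
  rw [hφ z hz, hφ _ (hdep z hz), hφ _ (orthogonal_starProjection_mem hdep hz)]
  exact factorsAlong_charFun_of_isGaussian hgauss hE z

/-! ### The product characteristic function -/

theorem Compatible.dep_starProjection_comm {E : Subsp n} (hE : Compatible ξ E) (x : Euc n) :
    (depSubspace ξ).starProjection (E.starProjection x) =
      E.starProjection ((depSubspace ξ).starProjection x) :=
  starProjection_comm_of_mapsTo (fun _ => hE.starProjection_mem_dep) x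

theorem Compatible.dep_orthogonal_starProjection_comm {E : Subsp n} (hE : Compatible ξ E)
    (x : Euc n) : (depSubspace ξ).starProjection (Eᗮ.starProjection x) =
      Eᗮ.starProjection ((depSubspace ξ).starProjection x) :=
  starProjection_comm_of_mapsTo
    (fun _ => orthogonal_starProjection_mem fun _ => hE.starProjection_mem_dep) x

/-- The characteristic function of `independentProd ξ μ`, written in terms of that of `μ`. -/
noncomputable def prodChar (ξ : Measure (Subsp n)) [IsProbabilityMeasure ξ] (μ : Measure (Euc n))
    (x : Euc n) : ℂ :=
  (∏ α : independentSubspaces ξ, charFun μ (α.1.starProjection x)) *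
    charFun μ ((depSubspace ξ).starProjection x)

theorem integral_exp_inner_marginal (μ : Measure (Euc n)) (F : Subsp n) (x : Euc n) :
    ∫ y : F, Complex.exp ((⟪(y : Euc n), x⟫ : ℝ) * Complex.I) ∂(marginal μ F) =
      charFun μ (F.starProjection x) := by
  rw [marginal, integral_map (by fun_prop) (by fun_prop), charFun_apply]
  congr with X
  rw [← F.inner_starProjection_left_eq_right]
  rfl

theorem charFun_independentProd (ξ : Measure (Subsp n)) [IsProbabilityMeasure ξ]
    (μ : Measure (Euc n)) [IsProbabilityMeasure μ] (x : Euc n) :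
    charFun (independentProd ξ μ) x = prodChar ξ μ x := by
  rw [independentProd, charFun_apply, integral_map (by fun_prop) (by fun_prop), prodChar]
  simp_rw [← integral_exp_inner_marginal]
  rw [← integral_fintype_prod_eq_prod
    (f := fun (α : independentSubspaces ξ) (y : α.1) =>
      Complex.exp ((⟪(y : Euc n), x⟫ : ℝ) * Complex.I)), ← integral_prod_mul]
  congr with p
  rw [← Complex.exp_sum, ← Complex.exp_add, inner_add_left, sum_inner]
  push_cast
  rw [add_mul, Finset.sum_mul]

theorem eq_independentProd_iff [IsProbabilityMeasure ξ] [IsProbabilityMeasure μ] :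
    μ = independentProd ξ μ ↔ ∀ x, charFun μ x = prodChar ξ μ x := by
  have : IsProbabilityMeasure (independentProd ξ μ) :=
    Measure.isProbabilityMeasure_map (by fun_prop)
  simp_rw [← charFun_independentProd]
  exact ⟨fun h x => congrArg (fun ν => charFun ν x) h,
    fun h => Measure.ext_of_charFun (funext h)⟩

theorem norm_prodChar_le_one (ξ : Measure (Subsp n)) [IsProbabilityMeasure ξ]
    (μ : Measure (Euc n)) [IsProbabilityMeasure μ] (x : Euc n) : ‖prodChar ξ μ x‖ ≤ 1 := by
  rw [prodChar, norm_mul, norm_prod]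
  exact mul_le_one₀ (Finset.prod_le_one (fun _ _ => norm_nonneg _)
    fun _ _ => norm_charFun_le_one _) (norm_nonneg _) (norm_charFun_le_one _)

theorem Compatible.factorsAlong_prodChar [IsProbabilityMeasure ξ] [IsProbabilityMeasure μ]
    {E : Subsp n} (hE : Compatible ξ E)
    (hdep : ∀ z ∈ depSubspace ξ,
      charFun μ z = charFun μ (E.starProjection z) * charFun μ (Eᗮ.starProjection z)) :
    FactorsAlong (prodChar ξ μ) E := by
  intro x
  simp only [prodChar]
  rw [hdep _ (Submodule.starProjection_apply_mem _ x), mul_mul_mul_comm, ← Finset.prod_mul_distrib,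
    hE.dep_starProjection_comm, hE.dep_orthogonal_starProjection_comm]
  congr 1
  refine Finset.prod_congr rfl fun α _ => ?_
  rcases hE α.1 α.2 with h | h
  · simp [starProjection_apply_of_le h]
  · simp [starProjection_apply_of_le_orthogonal h]

theorem sum_starProjection_add_dep (ξ : Measure (Subsp n)) [IsProbabilityMeasure ξ] (x : Euc n) :
    ∑ α : independentSubspaces ξ, α.1.starProjection x + (depSubspace ξ).starProjection x = x := by
  let W := sSup (independentSubspaces ξ)
  have hort : OrthogonalFamily ℝ (fun α : independentSubspaces ξ => α.1)
      fun α => α.1.subtypeₗᵢ :=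
    OrthogonalFamily.of_pairwise fun α β hαβ => independentSubspaces_pairwise ξ α.2 β.2
      (Subtype.coe_injective.ne hαβ)
  have hW : W.starProjection x ∈ iSup fun α : independentSubspaces ξ => α.1 := by
    rw [← sSup_eq_iSup']
    exact W.starProjection_apply_mem x
  calc _ = ∑ α : independentSubspaces ξ, α.1.starProjection (W.starProjection x) +
        Wᗮ.starProjection x := by
        congr 1
        exact Finset.sum_congr rfl fun α _ => (starProjection_apply_of_le (le_sSup α.2) x).1.symm
    _ = W.starProjection x + Wᗮ.starProjection x := by
        congr 1
        exact hort.sum_projection_of_mem_iSup _ hW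
    _ = x := W.starProjection_add_starProjection_orthogonal x

section CharFun

variable {H : Type*} [NormedAddCommGroup H] [InnerProductSpace ℝ H] {V : Submodule ℝ H}
  [V.HasOrthogonalProjection]

theorem norm_exp_inner_sub_one_le {z : H} (hz : z ∈ V) (X : H) :
    ‖Complex.exp ((⟪X, z⟫ : ℝ) * Complex.I) - 1‖ ≤ ‖V.starProjection X‖ * ‖z‖ := by
  rw [mul_comm (_ : ℂ)]
  refine Real.norm_exp_I_mul_ofReal_sub_one_le.trans ?_
  rw [← V.starProjection_eq_self_iff.2 hz, ← V.inner_starProjection_left_eq_right,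
    V.starProjection_eq_self_iff.2 hz]
  exact abs_real_inner_le_norm _ _

variable [MeasurableSpace H] [BorelSpace H] [SecondCountableTopology H] {μ : Measure H}
  [IsProbabilityMeasure μ]

theorem norm_charFun_add_sub_le
    (hV : Integrable (fun X => V.starProjection X) μ) (a : H) {z : H} (hz : z ∈ V) :
    ‖charFun μ (a + z) - charFun μ a‖ ≤ (∫ X, ‖V.starProjection X‖ ∂μ) * ‖z‖ := by
  have hexp (y : H) : Integrable (fun X => Complex.exp ((⟪X, y⟫ : ℝ) * Complex.I)) μ :=
    .of_bound (by fun_prop) 1 (.of_forall fun X => (Complex.norm_exp_ofReal_mul_I _).le)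
  rw [charFun_apply, charFun_apply, ← integral_sub (hexp _) (hexp _), ← integral_mul_const]
  refine norm_integral_le_of_norm_le (hV.norm.mul_const _) (.of_forall fun X => ?_)
  calc _ = ‖Complex.exp ((⟪X, a⟫ : ℝ) * Complex.I) *
        (Complex.exp ((⟪X, z⟫ : ℝ) * Complex.I) - 1)‖ := by
        rw [mul_sub, ← Complex.exp_add, inner_add_right]
        push_cast
        ring_nf
    _ ≤ ‖V.starProjection X‖ * ‖z‖ := by
        rw [norm_mul, Complex.norm_exp_ofReal_mul_I, one_mul]
        exact norm_exp_inner_sub_one_le hz X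

theorem norm_charFun_add_sub_mul_le
    (hV : Integrable (fun X => V.starProjection X) μ) (a : H) {z : H} (hz : z ∈ V) :
    ‖charFun μ (a + z) - charFun μ a * charFun μ z‖ ≤
      2 * (∫ X, ‖V.starProjection X‖ ∂μ) * ‖z‖ := by
  have hz1 : ‖charFun μ z - 1‖ ≤ (∫ X, ‖V.starProjection X‖ ∂μ) * ‖z‖ := by
    simpa using norm_charFun_add_sub_le hV 0 hz
  calc _ = ‖(charFun μ (a + z) - charFun μ a) - charFun μ a * (charFun μ z - 1)‖ := by ring_nf
    _ ≤ ‖charFun μ (a + z) - charFun μ a‖ + ‖charFun μ a‖ * ‖charFun μ z - 1‖ := by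
      rw [← norm_mul]
      exact norm_sub_le _ _
    _ ≤ (∫ X, ‖V.starProjection X‖ ∂μ) * ‖z‖ + 1 * ((∫ X, ‖V.starProjection X‖ ∂μ) * ‖z‖) := by
      gcongr
      exacts [norm_charFun_add_sub_le hV a hz, norm_charFun_le_one _]
    _ = _ := by ring

end CharFun

/-! ### The potential of mixed components -/

theorem ContractedOn.zero (ξ : Measure (Subsp n)) (D : Set (Euc n)) : ContractedOn ξ 0 D :=
  ⟨0, zero_lt_one, fun x _ => by simp [splitOp]⟩

theorem splitOp_add {L : Euc n → ℝ≥0∞} (hL : Measurable L) (L' : Euc n → ℝ≥0∞) (x : Euc n) :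
    splitOp ξ (L + L') x = splitOp ξ L x + splitOp ξ L' x := by
  have hLx : Measurable fun E : Subsp n => L (E.starProjection x) + L (Eᗮ.starProjection x) :=
    (hL.comp (measurable_starProjection_apply x)).add
      (hL.comp (measurable_orthogonal_starProjection_apply x))
  simp only [splitOp]
  rw [← lintegral_add_left hLx]
  exact lintegral_congr fun E => add_add_add_comm _ _ _ _

theorem ContractedOn.add {L L' : Euc n → ℝ≥0∞} {D : Set (Euc n)} (hm : Measurable L)
    (hL : ContractedOn ξ L D) (hL' : ContractedOn ξ L' D) : ContractedOn ξ (L + L') D := by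
  obtain ⟨ρ, hρ, h⟩ := hL
  obtain ⟨ρ', hρ', h'⟩ := hL'
  refine ⟨max ρ ρ', max_lt hρ hρ', fun x hx => ?_⟩
  calc splitOp ξ (L + L') x = splitOp ξ L x + splitOp ξ L' x := splitOp_add hm L' x
    _ ≤ ρ * L x + ρ' * L' x := add_le_add (h x hx) (h' x hx)
    _ ≤ max ρ ρ' * L x + max ρ ρ' * L' x := by
        gcongr
        exacts [le_max_left _ _, le_max_right _ _]
    _ = max ρ ρ' * (L + L') x := (mul_add _ _ _).symm

theorem ContractedOn.sum {ι : Type*} {L : ι → Euc n → ℝ≥0∞} {D : Set (Euc n)} (s : Finset ι)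
    (hm : ∀ i, Measurable (L i)) (hL : ∀ i, ContractedOn ξ (L i) D) :
    ContractedOn ξ (∑ i ∈ s, L i) D := by
  classical
  induction s using Finset.induction_on with
  | empty => exact ContractedOn.zero ξ D
  | insert i s hi ih =>
    rw [Finset.sum_insert hi]
    exact (hL i).add (hm i) ih

open Classical in
/-- The indicator that `F` and `G` are distinct and `x` has a nonzero component in both. When `F`
and `G` are independent subspaces it is contracted, because they lie on different sides of `E`
with positive probability. -/
noncomputable def pairIndicator (F G : Subsp n) (x : Euc n) : ℝ≥0∞ :=
  if F ≠ G ∧ F.starProjection x ≠ 0 ∧ G.starProjection x ≠ 0 then 1 else 0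

open Classical in
/-- The length of the component of `x` in `V`, if the component in `F` is nonzero. When `V` is the
dependent and `F` an independent subspace it is contracted, because only the part of the component
in `V` that stays on the side of `F` contributes. -/
noncomputable def attachedNorm (V F : Subsp n) (x : Euc n) : ℝ≥0∞ :=
  if F.starProjection x ≠ 0 then ‖V.starProjection x‖ₑ else 0

theorem measurableSet_starProjection_ne_zero (F : Subsp n) :
    MeasurableSet {x : Euc n | F.starProjection x ≠ 0} :=
  (isOpen_ne_fun F.starProjection.continuous continuous_const).measurableSet

theorem measurable_pairIndicator (F G : Subsp n) : Measurable (pairIndicator F G) :=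
  .ite ((MeasurableSet.const _).inter ((measurableSet_starProjection_ne_zero F).inter
    (measurableSet_starProjection_ne_zero G))) measurable_const measurable_const

theorem measurable_attachedNorm (V F : Subsp n) : Measurable (attachedNorm V F) :=
  .ite (measurableSet_starProjection_ne_zero F) (by fun_prop) measurable_const

theorem Compatible.pairIndicator_add_le {E F G : Subsp n} (hE : Compatible ξ E)
    (hF : F ∈ independentSubspaces ξ) (hG : G ∈ independentSubspaces ξ) (x : Euc n) :
    pairIndicator F G (E.starProjection x) + pairIndicator F G (Eᗮ.starProjection x) ≤
      {E : Subsp n | F ≤ E ↔ G ≤ E}.indicator (fun _ => pairIndicator F G x) E := by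
  have hside (H : Subsp n) (hH : H ∈ independentSubspaces ξ) :
      (H ≤ E ∧ H.starProjection (E.starProjection x) = H.starProjection x ∧
        H.starProjection (Eᗮ.starProjection x) = 0) ∨
      (¬ H ≤ E ∧ H.starProjection (E.starProjection x) = 0 ∧
        H.starProjection (Eᗮ.starProjection x) = H.starProjection x) := by
    by_cases hHE : H ≤ E
    · exact Or.inl ⟨hHE, starProjection_apply_of_le hHE x⟩
    · exact Or.inr ⟨hHE,
        starProjection_apply_of_le_orthogonal ((hE H hH).resolve_left hHE) x⟩
  rcases hside F hF with ⟨hFE, hF1, hF2⟩ | ⟨hFE, hF1, hF2⟩ <;>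
    rcases hside G hG with ⟨hGE, hG1, hG2⟩ | ⟨hGE, hG1, hG2⟩ <;>
    simp [pairIndicator, Set.indicator, hFE, hF1, hF2, hGE, hG1, hG2,
      -Submodule.starProjection_orthogonal_val]

theorem contractedOn_pairIndicator [IsProbabilityMeasure ξ] {F G : Subsp n}
    (hF : F ∈ independentSubspaces ξ) (hG : G ∈ independentSubspaces ξ) :
    ContractedOn ξ (pairIndicator F G) Set.univ := by
  by_cases hne : F = G
  · exact ⟨0, zero_lt_one, fun x _ => by simp [splitOp, pairIndicator, hne]⟩
  let S : Set (Subsp n) := {E | F ≤ E ↔ G ≤ E}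
  have hS : MeasurableSet S := (measurableSet_setOf_le F).iff (measurableSet_setOf_le G)
  refine ⟨ξ S, lt_of_le_of_ne prob_le_one fun h => not_ae_le_iff_le hF hG hne
    ((mem_ae_iff_prob_eq_one hS).2 h), fun x _ => ?_⟩
  calc splitOp ξ (pairIndicator F G) x ≤ ∫⁻ E, S.indicator (fun _ => pairIndicator F G x) E ∂ξ :=
        lintegral_mono_ae
          ((ae_compatible ξ).mono fun _ hE => hE.pairIndicator_add_le hF hG x)
    _ = ξ S * pairIndicator F G x := by rw [lintegral_indicator_const hS, mul_comm]

theorem Compatible.attachedNorm_add {E F : Subsp n} (hE : Compatible ξ E)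
    (hF : F ∈ independentSubspaces ξ) {x : Euc n} (hx : F.starProjection x ≠ 0) :
    attachedNorm (depSubspace ξ) F (E.starProjection x) +
        attachedNorm (depSubspace ξ) F (Eᗮ.starProjection x) =
      ‖sideProj F E ((depSubspace ξ).starProjection x)‖ₑ := by
  by_cases hFE : F ≤ E
  · simp [attachedNorm, sideProj, hFE, hx, starProjection_apply_of_le hFE,
      hE.dep_starProjection_comm]
  · simp [attachedNorm, sideProj, hFE, hx, hE.dep_orthogonal_starProjection_comm,
      starProjection_apply_of_le_orthogonal ((hE F hF).resolve_left hFE),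
      -Submodule.starProjection_orthogonal_val]

theorem Compatible.attachedNorm_eq_zero {E F : Subsp n} (hE : Compatible ξ E)
    (hF : F ∈ independentSubspaces ξ) {x : Euc n} (hx : F.starProjection x = 0) (V : Subsp n) :
    attachedNorm V F (E.starProjection x) = 0 ∧ attachedNorm V F (Eᗮ.starProjection x) = 0 := by
  rcases hE F hF with h | h
  · simp [attachedNorm, starProjection_apply_of_le h, hx]
  · simp [attachedNorm, starProjection_apply_of_le_orthogonal h, hx]

theorem contractedOn_attachedNorm [IsProbabilityMeasure ξ] {F : Subsp n}
    (hF : F ∈ independentSubspaces ξ) :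
    ContractedOn ξ (attachedNorm (depSubspace ξ) F) Set.univ := by
  obtain ⟨ρ, hρ, hle⟩ := exists_lintegral_sideProj_le ξ F
  refine ⟨ρ, hρ, fun x _ => ?_⟩
  by_cases hx : F.starProjection x = 0
  · have hzero : splitOp ξ (attachedNorm (depSubspace ξ) F) x = 0 :=
      lintegral_eq_zero_of_ae_eq_zero ((ae_compatible ξ).mono fun E hE => by
        obtain ⟨h1, h2⟩ := hE.attachedNorm_eq_zero hF hx (depSubspace ξ)
        simp only [h1, h2, add_zero, Pi.zero_apply])
    rw [hzero]
    exact zero_le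
  · calc splitOp ξ (attachedNorm (depSubspace ξ) F) x
        = ∫⁻ E, ‖sideProj F E ((depSubspace ξ).starProjection x)‖ₑ ∂ξ :=
          lintegral_congr_ae ((ae_compatible ξ).mono fun E hE => hE.attachedNorm_add hF hx)
      _ ≤ ρ * ‖(depSubspace ξ).starProjection x‖ₑ :=
          hle _ ((depSubspace ξ).starProjection_apply_mem x)
      _ = ρ * attachedNorm (depSubspace ξ) F x := by simp [attachedNorm, hx]

/-- The contracted function that dominates `‖charFun μ - prodChar ξ μ‖` up to a constant: it
detects the vectors with components in two independent subspaces, or in an independent and the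
dependent subspace. -/
noncomputable def mixingPotential (ξ : Measure (Subsp n)) [IsProbabilityMeasure ξ] :
    Euc n → ℝ≥0∞ :=
  ∑ p : independentSubspaces ξ × independentSubspaces ξ, pairIndicator p.1.1 p.2.1 +
    ∑ α : independentSubspaces ξ, attachedNorm (depSubspace ξ) α.1

theorem contractedOn_mixingPotential (ξ : Measure (Subsp n)) [IsProbabilityMeasure ξ] :
    ContractedOn ξ (mixingPotential ξ) Set.univ :=
  (ContractedOn.sum _ (fun _ => measurable_pairIndicator _ _)
    fun p => contractedOn_pairIndicator p.1.2 p.2.2).add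
    (Finset.sum_induction _ Measurable (fun _ _ => Measurable.add) measurable_zero
      fun _ _ => measurable_pairIndicator _ _)
    (ContractedOn.sum _ (fun _ => measurable_attachedNorm _ _)
      fun α => contractedOn_attachedNorm α.2)

theorem mixingPotential_ne_top (ξ : Measure (Subsp n)) [IsProbabilityMeasure ξ] (x : Euc n) :
    mixingPotential ξ x ≠ ∞ := by
  simp only [mixingPotential, Pi.add_apply, Finset.sum_apply]
  refine ENNReal.add_ne_top.2 ⟨ENNReal.sum_ne_top.2 fun _ _ => ?_,
    ENNReal.sum_ne_top.2 fun _ _ => ?_⟩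
  · unfold pairIndicator
    split_ifs <;> simp
  · unfold attachedNorm
    split_ifs <;> simp

theorem one_le_mixingPotential [IsProbabilityMeasure ξ] {α β : independentSubspaces ξ}
    (hne : α ≠ β) {x : Euc n} (hα : α.1.starProjection x ≠ 0) (hβ : β.1.starProjection x ≠ 0) :
    1 ≤ mixingPotential ξ x := by
  simp only [mixingPotential, Pi.add_apply, Finset.sum_apply]
  calc (1 : ℝ≥0∞) = pairIndicator α.1 β.1 x := by
        simp [pairIndicator, hα, hβ, Subtype.coe_injective.ne hne]
    _ ≤ ∑ p : independentSubspaces ξ × independentSubspaces ξ, pairIndicator p.1.1 p.2.1 x :=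
        Finset.single_le_sum
          (f := fun p : independentSubspaces ξ × independentSubspaces ξ =>
            pairIndicator p.1.1 p.2.1 x)
          (fun _ _ => zero_le) (Finset.mem_univ (α, β))
    _ ≤ _ := le_self_add

theorem enorm_dep_le_mixingPotential [IsProbabilityMeasure ξ] {α : independentSubspaces ξ}
    {x : Euc n} (hα : α.1.starProjection x ≠ 0) :
    ‖(depSubspace ξ).starProjection x‖ₑ ≤ mixingPotential ξ x := by
  simp only [mixingPotential, Pi.add_apply, Finset.sum_apply]
  calc ‖(depSubspace ξ).starProjection x‖ₑ = attachedNorm (depSubspace ξ) α.1 x := by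
        simp [attachedNorm, hα]
    _ ≤ ∑ α : independentSubspaces ξ, attachedNorm (depSubspace ξ) α.1 x :=
        Finset.single_le_sum
          (f := fun α : independentSubspaces ξ => attachedNorm (depSubspace ξ) α.1 x)
          (fun _ _ => zero_le) (Finset.mem_univ α)
    _ ≤ _ := le_add_self

theorem charFun_eq_prodChar_of_forall_eq_zero [IsProbabilityMeasure ξ] [IsProbabilityMeasure μ]
    {x : Euc n} (hx : ∀ α : independentSubspaces ξ, α.1.starProjection x = 0) :
    charFun μ x = prodChar ξ μ x := by
  have hdec := sum_starProjection_add_dep ξ x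
  simp only [hx, Finset.sum_const_zero, zero_add] at hdec
  simp [prodChar, hx, hdec]

theorem norm_charFun_sub_prodChar_le_of_unique [IsProbabilityMeasure ξ] [IsProbabilityMeasure μ]
    (hV : Integrable (fun X => (depSubspace ξ).starProjection X) μ) {x : Euc n}
    {α : independentSubspaces ξ} (hα : ∀ β, β ≠ α → β.1.starProjection x = 0) :
    ‖charFun μ x - prodChar ξ μ x‖ ≤
      2 * (∫ X, ‖(depSubspace ξ).starProjection X‖ ∂μ) * ‖(depSubspace ξ).starProjection x‖ := by
  have hsum : ∑ β : independentSubspaces ξ, β.1.starProjection x = α.1.starProjection x :=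
    Finset.sum_eq_single α (fun β _ hβ => hα β hβ) (by simp)
  have hdec := sum_starProjection_add_dep ξ x
  have hprod : prodChar ξ μ x = charFun μ (α.1.starProjection x) *
      charFun μ ((depSubspace ξ).starProjection x) := by
    rw [prodChar, Finset.prod_eq_single α (fun β _ hβ => by rw [hα β hβ]; simp) (by simp)]
  have hle := norm_charFun_add_sub_mul_le hV (α.1.starProjection x)
    ((depSubspace ξ).starProjection_apply_mem x)
  rwa [← hprod, ← hsum, hdec] at hle

theorem enorm_charFun_sub_prodChar_le [IsProbabilityMeasure ξ] [IsProbabilityMeasure μ]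
    (hV : Integrable (fun X => (depSubspace ξ).starProjection X) μ) (x : Euc n) :
    ‖charFun μ x - prodChar ξ μ x‖ₑ ≤
      ENNReal.ofReal (2 + 2 * ∫ X, ‖(depSubspace ξ).starProjection X‖ ∂μ) *
        mixingPotential ξ x := by
  have hM : 0 ≤ ∫ X, ‖(depSubspace ξ).starProjection X‖ ∂μ :=
    integral_nonneg fun X => norm_nonneg _
  by_cases hx : ∀ α : independentSubspaces ξ, α.1.starProjection x = 0
  · simp [charFun_eq_prodChar_of_forall_eq_zero hx]
  obtain ⟨α, hα⟩ := not_forall.1 hx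
  rw [← ofReal_norm]
  by_cases hunique : ∀ β, β ≠ α → β.1.starProjection x = 0
  · refine le_trans ?_ (mul_le_mul_right (enorm_dep_le_mixingPotential hα) _)
    rw [← ofReal_norm, ← ENNReal.ofReal_mul (by positivity)]
    refine ENNReal.ofReal_le_ofReal ((norm_charFun_sub_prodChar_le_of_unique hV hunique).trans ?_)
    gcongr
    exact le_add_of_nonneg_left zero_le_two
  · push Not at hunique
    obtain ⟨β, hne, hβ⟩ := hunique
    refine le_trans ?_ (le_mul_of_one_le_right' (one_le_mixingPotential hne hβ hα))
    refine ENNReal.ofReal_le_ofReal ((norm_sub_le _ _).trans ?_)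
    linarith [norm_charFun_le_one (μ := μ) x, norm_prodChar_le_one ξ μ x]

theorem IsMixture.charFun_eq_prodChar [IsProbabilityMeasure μ] [IsProbabilityMeasure ξ]
    (h : IsMixture μ ξ) (hV : Integrable (fun X => (depSubspace ξ).starProjection X) μ)
    (hdep : ∀ᵐ E : Subsp n ∂ξ, ∀ z ∈ depSubspace ξ,
      charFun μ z = charFun μ (E.starProjection z) * charFun μ (Eᗮ.starProjection z))
    (x : Euc n) : charFun μ x = prodChar ξ μ x := by
  have hle := le_of_subharmonic (ξ := ξ) (D := Set.univ) (N := 0) (by simp [SplitInvariant])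
    measurable_zero (by simp [splitOp]) (contractedOn_mixingPotential ξ)
    (fun y _ => mixingPotential_ne_top ξ y)
    (fun y _ => h.enorm_charFun_sub_le_splitOp (norm_prodChar_le_one ξ μ) (by
      filter_upwards [hdep, ae_compatible ξ] with E hE hc using hc.factorsAlong_prodChar hE y))
    ENNReal.ofReal_ne_top
    (fun y _ => by simpa using enorm_charFun_sub_prodChar_le hV y) x (Set.mem_univ x)
  simpa [sub_eq_zero] using hle

theorem integrable_log_marginal_iff (μ : Measure (Euc n)) (V : Subsp n) :
    Integrable (fun x : V => Real.log (1 + ‖x‖)) (marginal μ V) ↔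
      Integrable (fun X => Real.log (1 + ‖V.starProjection X‖)) μ := by
  rw [marginal, integrable_map_measure (Measurable.aestronglyMeasurable (by fun_prop))
    (by fun_prop)]
  rfl

theorem SplitsWrt.log_integrable_and_isMixture [IsProbabilityMeasure μ] [IsProbabilityMeasure ξ]
    (h : SplitsWrt μ ξ) :
    Integrable (fun x : depSubspace ξ => Real.log (1 + ‖x‖)) (marginal μ (depSubspace ξ)) ∧
      IsMixture μ ξ := by
  refine ⟨(integrable_log_marginal_iff _ _).2 ?_, h.isMixture⟩
  have hdep := h.isMixture.depSubspace_le_secondMomentSubspace fun F hF hinv hF0 =>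
    h.quadraticAlongSequence hF hinv hF0
  have hint := (memLp_starProjection_of_le_secondMomentSubspace hdep).integrable one_le_two
  refine hint.norm.mono' (Measurable.aestronglyMeasurable (by fun_prop)) (.of_forall fun X => ?_)
  have hpos : 0 < 1 + ‖(depSubspace ξ).starProjection X‖ := by positivity
  rw [Real.norm_of_nonneg (Real.log_nonneg (le_add_of_nonneg_right (norm_nonneg _)))]
  linarith [Real.log_le_sub_one_of_pos hpos]

theorem IsMixture.eq_independentProd_and_gaussian [IsProbabilityMeasure μ]
    [IsProbabilityMeasure ξ] (h : IsMixture μ ξ)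
    (hlog : Integrable (fun x : depSubspace ξ => Real.log (1 + ‖x‖))
      (marginal μ (depSubspace ξ))) :
    μ = independentProd ξ μ ∧ IsGaussian (marginal μ (depSubspace ξ)) ∧
      CovSplits μ (depSubspace ξ) ξ := by
  have hdep := h.depSubspace_le_secondMomentSubspace fun F hF hinv hF0 =>
    h.quadraticAlongSequence ((integrable_log_marginal_iff _ _).1 hlog) hF hinv hF0
  have hint := (memLp_starProjection_of_le_secondMomentSubspace hdep).integrable one_le_two
  obtain ⟨hg, hc⟩ := h.isGaussian_and_covSplits hdep
  exact ⟨eq_independentProd_iff.2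
    (h.charFun_eq_prodChar hint (ae_charFun_eq_mul_of_isGaussian hg hc)), hg, hc⟩

theorem splitsWrt_of_eq_independentProd [IsProbabilityMeasure μ] [IsProbabilityMeasure ξ]
    (h : μ = independentProd ξ μ) (hg : IsGaussian (marginal μ (depSubspace ξ)))
    (hc : CovSplits μ (depSubspace ξ) ξ) : SplitsWrt μ ξ := by
  have hφ : charFun μ = prodChar ξ μ := funext (eq_independentProd_iff.1 h)
  unfold SplitsWrt
  filter_upwards [ae_charFun_eq_mul_of_isGaussian hg hc, ae_compatible ξ] with E hE hcomp
  rw [splitsAlong_iff_factorsAlong, hφ]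
  exact hcomp.factorsAlong_prodChar hE

end SplittingMeasures

theorem theorem1 (n : ℕ)
    (ξ : MeasureTheory.Measure (SplittingMeasures.Subsp n)) [MeasureTheory.IsProbabilityMeasure ξ]
    (μ : MeasureTheory.Measure (SplittingMeasures.Euc n)) [MeasureTheory.IsProbabilityMeasure μ] :
    List.TFAE [
      SplittingMeasures.SplitsWrt μ ξ,
      μ = SplittingMeasures.independentProd ξ μ ∧
        ProbabilityTheory.IsGaussian
          (SplittingMeasures.marginal μ (SplittingMeasures.depSubspace ξ)) ∧
        SplittingMeasures.CovSplits μ (SplittingMeasures.depSubspace ξ) ξ,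
      MeasureTheory.Integrable (fun x : SplittingMeasures.depSubspace ξ => Real.log (1 + ‖x‖))
          (SplittingMeasures.marginal μ (SplittingMeasures.depSubspace ξ)) ∧
        SplittingMeasures.IsMixture μ ξ] := by
  tfae_have 1 → 3 := fun h => h.log_integrable_and_isMixture
  tfae_have 3 → 2 := fun h => h.2.eq_independentProd_and_gaussian h.1
  tfae_have 2 → 1 := fun h => SplittingMeasures.splitsWrt_of_eq_independentProd h.1 h.2.1 h.2.2
  tfae_finish
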